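/- Let $\Gamma$ be a group generated by a finite symmetric set $S$ (that is, $S=S^{-1}$), acting by permutations on a countably infinite set $X$. Let $S_\Gamma$ be the Schreier graph of the action: its vertex set is $X$, and distinct $x,y\in X$ are adjacent if $sx=y$ for some $s\in S$. Let $\beta X$ be the Stone–Čech compactification of the discrete set $X$, whose points are the ultrafilters on $X$, with the extended action of $\Gamma$, in which $g\omega$ is the ultrafilter $\{gA: A\in\omega\}$. Then the following are equivalent. 1. The action of $\Gamma$ on $X$ is hyperfinite: there is a regular Borel probability measure $\nu$ on $\beta X$, invariant under the extended action, and an ascending sequence $E_1\subseteq E_2\subseteq\dots$ of equivalence relations on $\beta X$, each with finite classes and each a Borel subset of $\beta X\times\beta X$ (in the product topology), such that for $\nu$-almost every $\omega\in\beta X$ the orbit $\Gamma\omega$ equals $\{\omega' : (\omega,\omega')\in\bigcup_n E_n\}$. 2. There is a hyperfinite Følner sequence in $S_\Gamma$: a sequence $(F_n)$ of nonempty finite subsets of $X$ such that the number of edges of $S_\Gamma$ between $F_n$ and $X\setminus F_n$, divided by $|F_n|$, tends to $0$, and such that for every $\varepsilon>0$ there is $K>0$ such that for every $n$ there is $Y_n\subseteq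 F_n$ with $|Y_n|<\varepsilon|F_n|$ for which all connected components of the subgraph of $S_\Gamma$ induced on $F_n\setminus Y_n$ have at most $K$ vertices. 3. There is a $\Gamma$-invariant mean $\mu$ on $X$ (a $\Gamma$-invariant, finitely additive map from the set of all subsets of $X$ to $[0,1]$ with $\mu(X)=1$) such that for every $\varepsilon>0$ there are $Y\subseteq X$ with $\mu(Y)<\varepsilon$ and $K>0$ such that all connected components of the subgraph of $S_\Gamma$ induced on $X\setminus Y$ have at most $K$ vertices. -/

import Mathlib

open MeasureTheory Filter Topology

/-! ### The Stone–Čech compactification of a set and the extended action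

The points of `βX` are the ultrafilters on `X`, with the topology generated by the sets
`U_A = {ω | A ∈ ω}`; this is Mathlib's topology on `Ultrafilter X`. -/

/-- The Borel σ-algebra of `βX`. -/
instance Ultrafilter.instMeasurableSpaceBeta {X : Type*} : MeasurableSpace (Ultrafilter X) :=
  borel (Ultrafilter X)

instance Ultrafilter.instBorelSpaceBeta {X : Type*} : BorelSpace (Ultrafilter X) := ⟨rfl⟩

/-- The extension of an action on `X` to `βX`: `g • ω` is the ultrafilter generated by the sets
`g • A`, `A ∈ ω`. -/
instance Ultrafilter.instMulActionBeta {Γ X : Type*} [Group Γ] [MulAction Γ X] :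
    MulAction Γ (Ultrafilter X) where
  smul g ω := ω.map (fun x => g • x)
  one_smul ω := by
    change ω.map (fun x => (1 : Γ) • x) = ω
    simp only [one_smul]
    exact Ultrafilter.map_id' ω
  mul_smul g h ω := by
    change ω.map (fun x => (g * h) • x) = (ω.map (fun x => h • x)).map (fun x => g • x)
    rw [Ultrafilter.map_map]
    congr 1
    funext x
    exact mul_smul g h x

/-- An action on a topological space `Z` with a Borel measure `ν` is hyperfinite if, up to
measure zero, the orbit equivalence relation is an ascending union of Borel equivalence relations
with finite classes. Borel refers to the product topology on `Z × Z`; when `Z` is not second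
countable (such as `βX`) the product of the Borel σ-algebras may be strictly smaller and need not
even contain the diagonal. -/
def IsHyperfiniteMeasureAction (Γ : Type*) {Z : Type*} [Group Γ] [MulAction Γ Z]
    [TopologicalSpace Z] [MeasurableSpace Z] (ν : Measure Z) : Prop :=
  ∃ E : ℕ → Setoid Z, Monotone E ∧
    (∀ n, MeasurableSet[borel (Z × Z)] {p : Z × Z | (E n) p.1 p.2}) ∧
    (∀ n z, {w : Z | (E n) z w}.Finite) ∧
    ∀ᵐ z ∂ν, ∀ w, w ∈ MulAction.orbit Γ z ↔ ∃ n, (E n) z w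

/-- The action of `Γ` on the set `X` is hyperfinite: `βX` admits a regular Borel probability
measure, invariant under the extended action, for which the extended action is hyperfinite. -/
def IsHyperfiniteSetAction (Γ X : Type*) [Group Γ] [MulAction Γ X] : Prop :=
  ∃ ν : Measure (Ultrafilter X), IsProbabilityMeasure ν ∧ ν.Regular ∧
    (∀ g : Γ, ν.map (fun ω => g • ω) = ν) ∧ IsHyperfiniteMeasureAction Γ ν

/-! ### Invariant means -/

/-- `μ` is a `Γ`-invariant mean on `X`: a `Γ`-invariant finitely additive map from the subsets of
`X` to `[0, 1]` with `μ X = 1`. -/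
structure IsInvariantMean (Γ : Type*) {X : Type*} [Group Γ] [MulAction Γ X]
    (μ : Set X → ℝ) : Prop where
  mem_Icc : ∀ A, μ A ∈ Set.Icc (0 : ℝ) 1
  univ : μ Set.univ = 1
  union : ∀ A B, Disjoint A B → μ (A ∪ B) = μ A + μ B
  invariant : ∀ (g : Γ) (A : Set X), μ ((fun x => g • x) '' A) = μ A

/-! ### Schreier graphs, Følner sequences, hyperfinite sequences of graphs -/

/-- The loopless Schreier graph of the action of `Γ` on `X` with respect to `S`: distinct `x`, `y`
are adjacent if `s • x = y` or `s • y = x` for some `s ∈ S`; for symmetric `S` these two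
conditions are the same. -/
def schreierGraph {Γ : Type*} (X : Type*) [Group Γ] [MulAction Γ X] (S : Finset Γ) :
    SimpleGraph X :=
  SimpleGraph.fromRel (fun x y => ∃ s ∈ S, s • x = y)

/-- All connected components of `G` have at most `K` vertices. -/
def SimpleGraph.ComponentsBoundedBy {V : Type*} (G : SimpleGraph V) (K : ℕ) : Prop :=
  ∀ c : G.ConnectedComponent, c.supp.encard ≤ K

/-- A sequence of finite graphs (of uniformly bounded degree) is hyperfinite if for every `ε > 0`
there is a `K > 0` such that from each `G n` one can remove less than `ε |V (G n)|` vertices so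
that all components of the remaining induced subgraph have size at most `K`. -/
def IsHyperfiniteSeq {V : ℕ → Type*} [∀ n, Fintype (V n)] (G : ∀ n, SimpleGraph (V n)) : Prop :=
  (∃ d : ℕ, ∀ n v, ((G n).neighborSet v).encard ≤ d) ∧
  ∀ ε : ℝ, 0 < ε → ∃ K : ℕ, 0 < K ∧ ∀ n, ∃ Y : Finset (V n),
    (Y.card : ℝ) < ε * Fintype.card (V n) ∧
      ((G n).induce {v | v ∉ Y}).ComponentsBoundedBy K

/-- The isoperimetric constant of a finite set `F` of vertices of `G`: the number of edges
leaving `F` divided by the number of vertices in `F`. -/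
noncomputable def SimpleGraph.isoConst {V : Type*} (G : SimpleGraph V) (F : Finset V) : ℝ :=
  ({p : V × V | p.1 ∈ F ∧ p.2 ∉ F ∧ G.Adj p.1 p.2}.ncard : ℝ) / F.card

/-- A Følner sequence in `G`: nonempty finite induced subgraphs, given by their vertex sets, whose
isoperimetric constants tend to zero. -/
def SimpleGraph.IsFolnerSeq {V : Type*} (G : SimpleGraph V) (F : ℕ → Finset V) : Prop :=
  (∀ n, (F n).Nonempty) ∧ Tendsto (fun n => G.isoConst (F n)) atTop (𝓝 0)

/-!
Everything is phrased with clusters: for a subset `W` of a `Γ`-set, the cluster of `a ∈ W` is the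
set of points reached from `a` by moving with generators inside `W`. For `W ⊆ X` the clusters are
the components of the induced Schreier graph, and the same notion makes sense in `βX`.

*From a hyperfinite extended action to a mean.* The mean of `A` is the measure of the clopen set
`betaSet A` of `βX`. If `n` is large, most `ω` lie in the measurable set `B` of points that `E n`
relates to all their neighbours, and `B` has finite clusters, because they sit in classes of `E n`.
Most of these are exhausted by words of a fixed length `N`. That property only involves finitely
many translates of `B`, so it survives when `B` is replaced by a clopen set `betaSet A` that is
close to `B` in measure; and it passes between `betaSet A` and `A` because `g • ω = h • ω` holds
exactly when `g • x = h • x` for `ω`-almost all `x` (`smul_eq_smul_iff_beta`). This is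
`exists_bounded_clusters_of_measure`.

*From a mean to a hyperfinite extended action.* A mean defines a content on `βX`, hence a regular
invariant Borel measure. For sets `Y m` with summable means, let `Z n` be the closed set of the `ω`
that contain the complement of every `Y m`, `m ≥ n`. The clusters of `Z n` are finite and increase
with `n`, and by Borel–Cantelli almost every orbit is eventually covered, see
`isHyperfiniteSetAction_of_mean`.

*From a Følner sequence to a mean.* The mean is a limit of densities along the Følner sequence.
Unless some `F n` is a finite invariant set, the sets `F n` grow, and a sparse subsequence is
disjoint and without edges between its members up to a vanishing proportion; then the sets that cut
the single `F n` glue to one subset of `X`, see `exists_mean_of_hyperfinite_folner`.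

*From a mean to a Følner sequence.* No convexity argument is needed: the Følner sets can be taken
among the clusters of the complement of a set `Y` of small mean. Edges leave such a cluster into `Y`
only, and the mass transport principle `IsInvariantMean.sum_nonneg_of_clusters` shows that sets of
small mean have small proportion in some cluster, see `exists_hyperfinite_folner_of_mean`.
-/

/-! ### Clusters and words -/

section Clusters

variable {Γ Z : Type*} [Group Γ] [MulAction Γ Z]

/-- One move by a generator from `a` to `b`, both endpoints being in `W`. -/
def GenStep (S : Finset Γ) (W : Set Z) (a b : Z) : Prop :=
  a ∈ W ∧ b ∈ W ∧ ∃ s ∈ S, s • a = b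

/-- The cluster of `a` in `W`: the points reached from `a` by moves inside `W`. For symmetric `S`
this is the connected component of `a` in the Schreier graph induced on `W` when `a ∈ W`, and it is
`{a}` when `a ∉ W`. -/
def cluster (S : Finset Γ) (W : Set Z) (a : Z) : Set Z :=
  {b | Relation.ReflTransGen (GenStep S W) a b}

variable {S : Finset Γ} {W W' : Set Z}

theorem GenStep.mono (h : W ⊆ W') {a b : Z} (hab : GenStep S W a b) : GenStep S W' a b :=
  ⟨h hab.1, h hab.2.1, hab.2.2⟩

theorem GenStep.symm (hS : ∀ s ∈ S, s⁻¹ ∈ S) {a b : Z} (hab : GenStep S W a b) :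
    GenStep S W b a := by
  obtain ⟨ha, hb, s, hs, rfl⟩ := hab
  exact ⟨hb, ha, s⁻¹, hS s hs, inv_smul_smul s a⟩

theorem mem_cluster_self (a : Z) : a ∈ cluster S W a := Relation.ReflTransGen.refl

theorem cluster_mono (h : W ⊆ W') (a : Z) : cluster S W a ⊆ cluster S W' a :=
  fun _ hb => Relation.ReflTransGen.mono (fun _ _ => GenStep.mono h) _ _ hb

theorem cluster_subset {a : Z} (ha : a ∈ W) : cluster S W a ⊆ W := by
  intro b hb
  induction hb with
  | refl => exact ha
  | tail _ h _ => exact h.2.1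

theorem cluster_symm (hS : ∀ s ∈ S, s⁻¹ ∈ S) {a b : Z} (h : b ∈ cluster S W a) :
    a ∈ cluster S W b := by
  induction h with
  | refl => exact mem_cluster_self _
  | tail _ h ih => exact Relation.ReflTransGen.head (h.symm hS) ih

theorem mem_cluster_of_smul_mem {a b : Z} {s : Γ} (hs : s ∈ S) (ha : a ∈ W)
    (hb : b ∈ cluster S W a) (hsb : s • b ∈ W) : s • b ∈ cluster S W a :=
  Relation.ReflTransGen.tail hb ⟨cluster_subset ha hb, hsb, s, hs, rfl⟩

/-- The group element spelled by a word in the generators; the head of the list acts first. -/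
def wordEval : List S → Γ
  | [] => 1
  | s :: l => wordEval l * s

/-- All moves of the path that the word `l` traces from `a` are inside `W`. The empty path makes no
move, so it puts no condition on `a`. -/
def PathIn (W : Set Z) : List S → Z → Prop
  | [], _ => True
  | s :: l, a => a ∈ W ∧ (s : Γ) • a ∈ W ∧ PathIn W l ((s : Γ) • a)

theorem mem_cluster_iff_word {a b : Z} :
    b ∈ cluster S W a ↔ ∃ l : List S, PathIn W l a ∧ wordEval l • a = b := by
  constructor
  · intro h
    induction h using Relation.ReflTransGen.head_induction_on with
    | refl => exact ⟨[], trivial, one_smul _ _⟩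
    | head h _ ih =>
      obtain ⟨ha, hb, s, hs, rfl⟩ := h
      obtain ⟨l, hl, rfl⟩ := ih
      exact ⟨⟨s, hs⟩ :: l, ⟨ha, hb, hl⟩, mul_smul _ _ _⟩
  · rintro ⟨l, hl, rfl⟩
    induction l generalizing a with
    | nil => simpa [wordEval] using mem_cluster_self a
    | cons s l ih =>
      rw [wordEval, mul_smul]
      exact Relation.ReflTransGen.head ⟨hl.1, hl.2.1, s, s.2, rfl⟩ (ih hl.2.2)

theorem pathIn_append_singleton {a : Z} {l : List S} {s : S} (hl : PathIn W l a)
    (h : GenStep S W (wordEval l • a) ((s : Γ) • wordEval l • a)) :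
    PathIn W (l ++ [s]) a ∧ wordEval (l ++ [s]) • a = (s : Γ) • wordEval l • a := by
  induction l generalizing a with
  | nil =>
    simp only [wordEval, one_smul] at h
    exact ⟨⟨h.1, h.2.1, trivial⟩, by simp [wordEval]⟩
  | cons t l ih =>
    simp only [wordEval, mul_smul] at h
    obtain ⟨h1, h2⟩ := ih hl.2.2 h
    exact ⟨⟨hl.1, hl.2.1, h1⟩, by simpa only [List.cons_append, wordEval, mul_smul] using h2⟩

/-- The cluster of `a` in `W` is exhausted by words of length `N`, expressed as: a path of
length at most `N + 1` leads to no point that paths of length at most `N` miss. -/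
def ExhaustedBy (S : Finset Γ) (N : ℕ) (W : Set Z) (a : Z) : Prop :=
  ∀ l : List S, l.length ≤ N + 1 → PathIn W l a →
    ∃ l' : List S, l'.length ≤ N ∧ PathIn W l' a ∧ wordEval l • a = wordEval l' • a

/-- The group elements spelled by words of length at most `N`. -/
def wordBall (S : Finset Γ) (N : ℕ) : Set Γ := wordEval (S := S) '' {l | l.length ≤ N}

theorem wordBall_finite (S : Finset Γ) (N : ℕ) : (wordBall S N).Finite :=
  (List.finite_length_le S N).image _

theorem ExhaustedBy.word {N : ℕ} {a b : Z} (h : ExhaustedBy S N W a) (hb : b ∈ cluster S W a) :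
    ∃ l : List S, l.length ≤ N ∧ PathIn W l a ∧ wordEval l • a = b := by
  induction hb with
  | refl => exact ⟨[], Nat.zero_le _, trivial, one_smul _ _⟩
  | tail _ hstep ih =>
    obtain ⟨l, hl, hp, rfl⟩ := ih
    obtain ⟨_, _, s, hs, rfl⟩ := id hstep
    obtain ⟨hp', he⟩ := pathIn_append_singleton (s := ⟨s, hs⟩) hp hstep
    obtain ⟨l', h1, h2, h3⟩ := h _ (by simpa using hl) hp'
    exact ⟨l', h1, h2, h3.symm.trans he⟩

theorem ExhaustedBy.cluster_subset {N : ℕ} {a : Z} (h : ExhaustedBy S N W a) :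
    cluster S W a ⊆ (fun g : Γ => g • a) '' wordBall S N := by
  intro b hb
  obtain ⟨l, hl, -, rfl⟩ := h.word hb
  exact ⟨_, ⟨l, hl, rfl⟩, rfl⟩

theorem ExhaustedBy.encard_le {N : ℕ} {a : Z} (h : ExhaustedBy S N W a) :
    (cluster S W a).encard ≤ (wordBall_finite S N).toFinset.card := by
  refine (Set.encard_le_encard h.cluster_subset).trans ((Set.encard_image_le _ _).trans ?_)
  rw [(wordBall_finite S N).encard_eq_coe_toFinset_card]

theorem exists_exhaustedBy_of_finite {a : Z} (h : (cluster S W a).Finite) :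
    ∃ N, ∀ M, N ≤ M → ExhaustedBy S M W a := by
  choose! w hw using fun b (hb : b ∈ cluster S W a) => mem_cluster_iff_word.1 hb
  obtain ⟨N, hN⟩ := (h.image fun b => (w b).length).bddAbove
  refine ⟨N, fun M hM l _ hp => ?_⟩
  have hb : wordEval l • a ∈ cluster S W a := mem_cluster_iff_word.2 ⟨l, hp, rfl⟩
  exact ⟨w _, (hN ⟨_, hb, rfl⟩).trans hM, (hw _ hb).1, (hw _ hb).2.symm⟩

theorem wordBall_cons {N : ℕ} {g : Γ} (hg : g ∈ wordBall S N) {s : Γ} (hs : s ∈ S) :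
    g * s ∈ wordBall S (N + 1) := by
  obtain ⟨l, hl, rfl⟩ := hg
  exact ⟨⟨s, hs⟩ :: l, by simpa using hl, rfl⟩

theorem pathIn_congr {N : ℕ} {a : Z} (h : ∀ g ∈ wordBall S N, g • a ∈ W ↔ g • a ∈ W')
    {l : List S} (hl : l.length ≤ N) : PathIn W l a ↔ PathIn W' l a := by
  induction l generalizing a N with
  | nil => exact Iff.rfl
  | cons s l ih =>
    obtain ⟨N, rfl⟩ : ∃ M, N = M + 1 := ⟨N - 1, by simp at hl; omega⟩
    have h0 : a ∈ W ↔ a ∈ W' := by simpa using h 1 ⟨[], Nat.zero_le _, rfl⟩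
    have h1 : (s : Γ) • a ∈ W ↔ (s : Γ) • a ∈ W' :=
      h s ⟨[s], by simp, by simp [wordEval]⟩
    refine and_congr h0 (and_congr h1 (ih (N := N) (fun g hg => ?_) (by simpa using hl)))
    simpa only [mul_smul] using h _ (wordBall_cons hg s.2)

/-- Exhaustion by words of length `N` is decided by `W` on the points `g • a` with `g` of word
length at most `N + 1`. -/
theorem exhaustedBy_congr {N : ℕ} {a : Z}
    (h : ∀ g ∈ wordBall S (N + 1), g • a ∈ W ↔ g • a ∈ W') :
    ExhaustedBy S N W a ↔ ExhaustedBy S N W' a := by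
  refine forall₂_congr fun l hl => imp_congr (pathIn_congr h hl) (exists_congr fun l' => ?_)
  exact and_congr_right fun hl' => and_congr_left fun _ => pathIn_congr h (hl'.trans N.le_succ)

end Clusters

/-! ### Components of induced Schreier graphs -/

section Components

variable {Γ X : Type*} [Group Γ] [MulAction Γ X] {S : Finset Γ}

theorem schreierGraph_adj (hS : ∀ s ∈ S, s⁻¹ ∈ S) {x y : X} :
    (schreierGraph X S).Adj x y ↔ x ≠ y ∧ ∃ s ∈ S, s • x = y := by
  rw [schreierGraph, SimpleGraph.fromRel_adj]
  refine and_congr_right fun _ => or_iff_left_of_imp ?_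
  rintro ⟨s, hs, rfl⟩
  exact ⟨s⁻¹, hS s hs, inv_smul_smul s y⟩

theorem SimpleGraph.componentsBoundedBy_iff {V : Type*} {G : SimpleGraph V} {K : ℕ} :
    G.ComponentsBoundedBy K ↔ ∀ v, {w | G.Reachable v w}.encard ≤ K := by
  have key : ∀ v, (G.connectedComponentMk v).supp = {w | G.Reachable v w} := by
    intro v
    ext w
    rw [SimpleGraph.ConnectedComponent.mem_supp_iff, SimpleGraph.ConnectedComponent.eq]
    exact ⟨fun h => h.symm, fun h => h.symm⟩
  constructor
  · intro h v
    rw [← key]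
    exact h _
  · intro h c
    induction c using SimpleGraph.ConnectedComponent.ind with
    | _ v => rw [key]; exact h v

/-- Reachability in a subgraph that sits over `A ⊆ X` stays in clusters of `A`. -/
theorem componentsBoundedBy_of_cluster {V : Type*} {G : SimpleGraph V} {K : ℕ} {A : Set X}
    (f : V → X) (hf : Function.Injective f)
    (hadj : ∀ u v, G.Adj u v → GenStep S A (f u) (f v))
    (hK : ∀ v, (cluster S A (f v)).encard ≤ K) : G.ComponentsBoundedBy K := by
  rw [SimpleGraph.componentsBoundedBy_iff]
  intro v
  refine (Set.encard_le_encard_of_injOn (f := f) ?_ hf.injOn).trans (hK v)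
  intro w hw
  rw [Set.mem_ofPred_eq, SimpleGraph.reachable_iff_reflTransGen] at hw
  exact Relation.ReflTransGen.lift f hadj _ _ hw

/-- Bounded components of a graph over `A ⊆ X` bound the clusters, provided that moves inside `A`
from a point under the graph are realised by reachability in the graph. -/
theorem encard_cluster_le_of_componentsBoundedBy {V : Type*} {G : SimpleGraph V} {K : ℕ}
    {A : Set X} (f : V → X)
    (hlift : ∀ u y, GenStep S A (f u) y → ∃ v, f v = y ∧ G.Reachable u v)
    (hK : G.ComponentsBoundedBy K) (v : V) : (cluster S A (f v)).encard ≤ K := by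
  rw [SimpleGraph.componentsBoundedBy_iff] at hK
  refine le_trans (Set.encard_le_encard ?_) ((Set.encard_image_le f _).trans (hK v))
  intro y hy
  induction hy with
  | refl => exact ⟨v, SimpleGraph.Reachable.refl _, rfl⟩
  | tail _ h ih =>
    obtain ⟨u, hu, rfl⟩ := ih
    obtain ⟨w, rfl, hw⟩ := hlift u _ h
    exact ⟨w, SimpleGraph.Reachable.trans hu hw, rfl⟩

theorem induce_componentsBoundedBy_iff (hS : ∀ s ∈ S, s⁻¹ ∈ S) {A : Set X} {K : ℕ} :
    ((schreierGraph X S).induce A).ComponentsBoundedBy K ↔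
      ∀ x ∈ A, (cluster S A x).encard ≤ K := by
  constructor
  · intro h x hx
    refine encard_cluster_le_of_componentsBoundedBy (fun v : A => (v : X)) ?_ h ⟨x, hx⟩
    rintro u y ⟨-, hy, s, hs, rfl⟩
    refine ⟨⟨_, hy⟩, rfl, ?_⟩
    by_cases heq : (u : X) = s • (u : X)
    · have : u = ⟨s • (u : X), hy⟩ := Subtype.ext heq
      rw [← this]
    · refine SimpleGraph.Adj.reachable ?_
      rw [SimpleGraph.comap_adj]
      exact (schreierGraph_adj hS).2 ⟨heq, s, hs, rfl⟩
  · intro h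
    refine componentsBoundedBy_of_cluster (S := S) (A := A) (fun v : A => (v : X))
      Subtype.val_injective ?_ fun v => h v v.2
    intro u v huv
    rw [SimpleGraph.comap_adj] at huv
    exact ⟨u.2, v.2, ((schreierGraph_adj hS).1 huv).2⟩

end Components

/-! ### The extended action on `βX` -/

section Beta

variable {Γ X : Type*} [Group Γ] [MulAction Γ X] {S : Finset Γ}

/-- The basic clopen subset of `βX` of all ultrafilters that contain `A`. -/
def betaSet (A : Set X) : Set (Ultrafilter X) := {ω | A ∈ ω}

theorem isClopen_betaSet (A : Set X) : IsClopen (betaSet A) :=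
  ⟨ultrafilter_isClosed_basic A, ultrafilter_isOpen_basic A⟩

theorem measurableSet_betaSet (A : Set X) : MeasurableSet (betaSet A) :=
  (isClopen_betaSet A).isOpen.measurableSet

theorem betaSet_compl (A : Set X) : betaSet Aᶜ = (betaSet A)ᶜ :=
  Set.ext fun _ => Ultrafilter.compl_mem_iff_notMem

theorem betaSet_union (A B : Set X) : betaSet (A ∪ B) = betaSet A ∪ betaSet B :=
  Set.ext fun _ => Ultrafilter.union_mem_iff

theorem betaSet_mono {A B : Set X} (h : A ⊆ B) : betaSet A ⊆ betaSet B :=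
  fun _ hA => mem_of_superset hA h

theorem disjoint_betaSet {A B : Set X} : Disjoint (betaSet A) (betaSet B) ↔ Disjoint A B := by
  rw [← Set.subset_compl_iff_disjoint_right, ← Set.subset_compl_iff_disjoint_right]
  refine ⟨fun h x hx hB => ?_, fun h => (betaSet_compl B) ▸ betaSet_mono h⟩
  exact h (show (pure x : Ultrafilter X) ∈ betaSet A from hx)
    (show (pure x : Ultrafilter X) ∈ betaSet B from hB)

theorem smul_mem_betaSet {g : Γ} {ω : Ultrafilter X} {A : Set X} :
    g • ω ∈ betaSet A ↔ ω ∈ betaSet {x | g • x ∈ A} := Iff.rfl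

theorem continuous_smul_beta (g : Γ) : Continuous fun ω : Ultrafilter X => g • ω := by
  refine continuous_generateFrom_iff.2 ?_
  rintro _ ⟨A, rfl⟩
  exact ultrafilter_isOpen_basic _

theorem exists_betaSet_eq {V : Set (Ultrafilter X)} (hV : IsClopen V) :
    ∃ A : Set X, V = betaSet A := by
  have key : ∀ U : Set (Ultrafilter X), IsOpen U → ∀ ω ∈ U, {x | (pure x : Ultrafilter X) ∈ U} ∈ ω :=
    fun U hU ω hω => Ultrafilter.tendsto_pure_self ω (hU.mem_nhds hω)
  refine ⟨{x | (pure x : Ultrafilter X) ∈ V}, Set.ext fun ω => ⟨key V hV.isOpen ω, fun h => ?_⟩⟩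
  by_contra hω
  exact Ultrafilter.compl_mem_iff_notMem.1 (key Vᶜ hV.compl.isOpen ω hω) h

theorem exists_betaSet_between {K O : Set (Ultrafilter X)} (hK : IsClosed K) (hO : IsOpen O)
    (h : K ⊆ O) : ∃ A : Set X, K ⊆ betaSet A ∧ betaSet A ⊆ O := by
  obtain ⟨V, hV, hKV, hVO⟩ := exists_clopen_of_closed_subset_open hK hO h
  obtain ⟨A, rfl⟩ := exists_betaSet_eq hV
  exact ⟨A, hKV, hVO⟩

/-- An ultrafilter fixed by `g` is concentrated on the fixed points of `g`. The points of `X` moved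
by `g` are covered by `A`, `gA` and `g⁻¹A` for a maximal set `A` with `gA ∩ A = ∅`, and none of these
three sets can belong to a fixed ultrafilter. -/
theorem fixedPoints_mem_of_smul_eq {g : Γ} {ω : Ultrafilter X} (h : g • ω = ω) :
    {x : X | g • x = x} ∈ ω := by
  have hinv : ∀ A : Set X, {x | g • x ∈ A} ∈ ω ↔ A ∈ ω := fun A =>
    (smul_mem_betaSet (g := g) (ω := ω) (A := A)).symm.trans (by rw [h]; exact Iff.rfl)
  obtain ⟨A, hA⟩ := zorn_subset {A : Set X | ∀ x ∈ A, g • x ∉ A} <| by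
    intro c hc hchain
    refine ⟨⋃₀ c, ?_, fun s hs => Set.subset_sUnion_of_mem hs⟩
    rintro x ⟨s, hs, hx⟩ ⟨t, ht, hgx⟩
    rcases hchain.total hs ht with hst | hts
    · exact hc ht x (hst hx) hgx
    · exact hc hs x hx (hts hgx)
  have hnot : A ∉ ω := by
    intro hAω
    obtain ⟨x, hx, hgx⟩ := ω.nonempty_of_mem (inter_mem hAω ((hinv A).2 hAω))
    exact hA.prop x hx hgx
  have hcover : {x | g • x = x} ∪ (A ∪ ({x | g • x ∈ A} ∪ {x | g⁻¹ • x ∈ A})) = Set.univ := by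
    refine Set.eq_univ_of_forall fun x => ?_
    by_contra hx
    simp only [Set.mem_union, not_or, Set.mem_ofPred_eq] at hx
    obtain ⟨h1, h2, h3, h4⟩ := hx
    refine h2 (hA.le_of_ge (y := insert x A) ?_ (Set.subset_insert x A) (Set.mem_insert x A))
    rintro y (rfl | hy) (hgy | hgy)
    · exact h1 hgy
    · exact h3 hgy
    · exact h4 (by rwa [← hgy, inv_smul_smul])
    · exact hA.prop y hy hgy
  have huniv : {x | g • x = x} ∪ (A ∪ ({x | g • x ∈ A} ∪ {x | g⁻¹ • x ∈ A})) ∈ ω := by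
    rw [hcover]
    exact univ_mem
  rw [Ultrafilter.union_mem_iff, Ultrafilter.union_mem_iff, Ultrafilter.union_mem_iff] at huniv
  rcases huniv with h1 | h1 | h1 | h1
  · exact h1
  · exact absurd h1 hnot
  · exact absurd ((hinv A).1 h1) hnot
  · refine absurd ?_ hnot
    rw [← hinv] at h1
    simpa using h1

theorem smul_eq_smul_iff_beta {g h : Γ} {ω : Ultrafilter X} :
    g • ω = h • ω ↔ {x : X | g • x = h • x} ∈ ω := by
  have hset : {x : X | g • x = h • x} = {x : X | (h⁻¹ * g) • x = x} := by
    ext x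
    simp only [Set.mem_ofPred_eq, mul_smul, inv_smul_eq_iff]
  constructor
  · intro hω
    rw [hset]
    exact fixedPoints_mem_of_smul_eq (by rw [mul_smul, hω, inv_smul_smul])
  · intro hω
    ext A
    refine (Filter.congr_sets ?_ :
      {x | g • x ∈ A} ∈ (ω : Filter X) ↔ {x | h • x ∈ A} ∈ (ω : Filter X))
    filter_upwards [hω] with x hx
    rw [show g • x = h • x from hx]

theorem pathIn_betaSet {A : Set X} {l : List S} {ω : Ultrafilter X} :
    PathIn (betaSet A) l ω ↔ ∀ᶠ x in (ω : Filter X), PathIn A l x := by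
  induction l generalizing ω with
  | nil => simp [PathIn]
  | cons s l ih =>
    simp only [PathIn, eventually_and, ih]
    exact Iff.rfl

/-- Exhaustion at `ω` in a clopen set is exhaustion at `ω`-almost every point of `X`: it involves
finitely many words, and equality of translates of `ω` is detected in `X`. -/
theorem exhaustedBy_betaSet {N : ℕ} {A : Set X} {ω : Ultrafilter X} :
    ExhaustedBy S N (betaSet A) ω ↔ ∀ᶠ x in (ω : Filter X), ExhaustedBy S N A x := by
  simp only [ExhaustedBy]
  refine Iff.trans ?_ (eventually_all_finite (List.finite_length_le S (N + 1))).symm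
  refine forall₂_congr fun l _ => ?_
  rw [Ultrafilter.eventually_imp]
  refine imp_congr pathIn_betaSet (Iff.trans (exists_congr fun l' => and_congr_right fun _ => ?_)
    (Ultrafilter.eventually_exists_mem_iff (List.finite_length_le S N)).symm)
  rw [eventually_and, pathIn_betaSet, smul_eq_smul_iff_beta]
  exact Iff.rfl

/-- A bound on the clusters of `A` carries over to `betaSet A`: distinct points of a cluster in `βX`
give distinct points of a cluster of `A` at `ω`-almost every `x`. -/
theorem encard_cluster_betaSet_le {A : Set X} {K : ℕ}
    (hA : ∀ x ∈ A, (cluster S A x).encard ≤ K) {ω : Ultrafilter X} (hω : ω ∈ betaSet A) :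
    (cluster S (betaSet A) ω).encard ≤ K := by
  by_contra! hlt
  obtain ⟨T, hT, hcard⟩ := Set.exists_subset_encard_eq (Order.add_one_le_of_lt hlt)
  have hfin : T.Finite := Set.finite_of_encard_eq_coe (k := K + 1) (by simpa using hcard)
  choose! w hw using fun b (hb : b ∈ T) => mem_cluster_iff_word.1 (hT hb)
  have h1 : ∀ᶠ x in (ω : Filter X), ∀ b ∈ T, PathIn A (w b) x :=
    (eventually_all_finite hfin).2 fun b hb => pathIn_betaSet.1 (hw b hb).1
  have h2 : ∀ᶠ x in (ω : Filter X), ∀ b ∈ T, ∀ c ∈ T, b ≠ c →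
      wordEval (w b) • x ≠ wordEval (w c) • x := by
    refine (eventually_all_finite hfin).2 fun b hb => (eventually_all_finite hfin).2 fun c hc => ?_
    by_cases hbc : b = c
    · exact Eventually.of_forall fun _ h => absurd hbc h
    · have : wordEval (w b) • ω ≠ wordEval (w c) • ω := by rwa [(hw b hb).2, (hw c hc).2]
      rw [Ne, smul_eq_smul_iff_beta, ← Ultrafilter.compl_mem_iff_notMem] at this
      filter_upwards [this] with x hx _ using hx
  obtain ⟨x, hxA, hx1, hx2⟩ := (Filter.Eventually.and hω (h1.and h2)).exists
  have hle : T.encard ≤ (cluster S A x).encard := by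
    refine Set.encard_le_encard_of_injOn (f := fun b => wordEval (w b) • x) ?_ ?_
    · exact fun b hb => mem_cluster_iff_word.2 ⟨_, hx1 b hb, rfl⟩
    · intro b hb c hc hbc
      by_contra hne
      exact hx2 b hb c hc hne hbc
  rw [hcard] at hle
  have := hle.trans (hA x hxA)
  exact absurd this (by exact_mod_cast (Nat.lt_succ_self K).not_ge)

theorem measurableSet_pathIn {W : Set (Ultrafilter X)} (hW : MeasurableSet W) (l : List S) :
    MeasurableSet {ω | PathIn W l ω} := by
  induction l with
  | nil => simp [PathIn]
  | cons s l ih =>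
    have hs := (continuous_smul_beta (X := X) (s : Γ)).measurable
    exact hW.inter ((hs hW).inter (hs ih))

theorem measurableSet_exhaustedBy {W : Set (Ultrafilter X)} (hW : MeasurableSet W) (N : ℕ) :
    MeasurableSet {ω | ExhaustedBy S N W ω} := by
  have heq : ∀ g h : Γ, MeasurableSet {ω : Ultrafilter X | g • ω = h • ω} := fun g h =>
    (isClosed_eq (continuous_smul_beta g) (continuous_smul_beta h)).measurableSet
  have hset : {ω : Ultrafilter X | ExhaustedBy S N W ω} =
      ⋂ (l : List S) (_ : l.length ≤ N + 1), ({ω | PathIn W l ω}ᶜ ∪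
        ⋃ (l' : List S) (_ : l'.length ≤ N),
          ({ω | PathIn W l' ω} ∩ {ω | wordEval l • ω = wordEval l' • ω})) := by
    ext ω
    simp [ExhaustedBy, imp_iff_not_or, and_left_comm]
  rw [hset]
  exact MeasurableSet.iInter fun l => MeasurableSet.iInter fun _ =>
    (measurableSet_pathIn hW l).compl.union (MeasurableSet.iUnion fun l' =>
      MeasurableSet.iUnion fun _ => (measurableSet_pathIn hW l').inter (heq _ _))

end Beta

/-! ### From a hyperfinite extended action to an invariant mean -/

section MeanOfMeasure

theorem exists_measure_compl_lt {Ω : Type*} [MeasurableSpace Ω] (ν : Measure Ω) [IsFiniteMeasure ν]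
    {W : ℕ → Set Ω} (hW : ∀ n, MeasurableSet (W n)) (h : ∀ᵐ ω ∂ν, ∀ᶠ n in atTop, ω ∈ W n)
    {e : ENNReal} (he : 0 < e) : ∃ n, ν (W n)ᶜ < e := by
  have hlim := tendsto_measure_of_ae_tendsto_indicator_of_isFiniteMeasure (μ := ν) atTop
    (A := ∅) (As := fun n => (W n)ᶜ) MeasurableSet.empty (fun n => (hW n).compl)
    (h.mono fun ω hω => hω.mono fun n hn => by simpa using hn)
  rw [measure_empty] at hlim
  exact (hlim.eventually_lt_const he).exists

variable {Γ X : Type*} [Group Γ] [MulAction Γ X] {S : Finset Γ}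

theorem exists_betaSet_symmDiff_lt (ν : Measure (Ultrafilter X)) [IsFiniteMeasure ν] [ν.Regular]
    {B : Set (Ultrafilter X)} (hB : MeasurableSet B) {e : ENNReal} (he : e ≠ 0) :
    ∃ A : Set X, ν (symmDiff B (betaSet A)) < e := by
  have he2 : e / 2 ≠ 0 := by simpa using he
  obtain ⟨F, hFB, hF, hνF⟩ := hB.exists_isClosed_sdiff_lt (measure_ne_top ν B) he2
  obtain ⟨O, hBO, hO, -, hνO⟩ := hB.exists_isOpen_sdiff_lt (measure_ne_top ν B) he2
  obtain ⟨A, hFA, hAO⟩ := exists_betaSet_between hF hO (hFB.trans hBO)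
  refine ⟨A, ?_⟩
  calc ν (symmDiff B (betaSet A)) ≤ ν ((B \ F) ∪ (O \ B)) := by
        refine measure_mono ?_
        rintro ω (⟨h1, h2⟩ | ⟨h1, h2⟩)
        · exact Or.inl ⟨h1, fun h => h2 (hFA h)⟩
        · exact Or.inr ⟨hAO h1, h2⟩
    _ ≤ ν (B \ F) + ν (O \ B) := measure_union_le _ _
    _ < e / 2 + e / 2 := ENNReal.add_lt_add hνF hνO
    _ = e := ENNReal.add_halves e

theorem measure_preimage_smul_beta {ν : Measure (Ultrafilter X)}
    (hinv : ∀ g : Γ, ν.map (fun ω => g • ω) = ν) (g : Γ) {B : Set (Ultrafilter X)}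
    (hB : MeasurableSet B) : ν ((fun ω => g • ω) ⁻¹' B) = ν B := by
  rw [← Measure.map_apply (continuous_smul_beta g).measurable hB, hinv]

theorem isInvariantMean_of_measure {ν : Measure (Ultrafilter X)} [IsProbabilityMeasure ν]
    (hinv : ∀ g : Γ, ν.map (fun ω => g • ω) = ν) :
    IsInvariantMean Γ fun A : Set X => ν.real (betaSet A) where
  mem_Icc A := ⟨measureReal_nonneg, measureReal_le_one⟩
  univ := by
    have : betaSet (Set.univ : Set X) = Set.univ := Set.eq_univ_of_forall fun _ => univ_mem
    simp [this]
  union A B hAB := by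
    rw [betaSet_union, measureReal_union (disjoint_betaSet.2 hAB) (measurableSet_betaSet B)]
  invariant g A := by
    rw [measureReal_def, measureReal_def,
      ← measure_preimage_smul_beta hinv g (measurableSet_betaSet _)]
    congr 2
    ext ω
    have : {x | g • x ∈ (fun x => g • x) '' A} = A := by
      ext x
      simp
    rw [Set.mem_preimage, smul_mem_betaSet, this]

/-- A hyperfinite extended action gives a subset of `X` of small measure in `βX` off which the
clusters are bounded. The measurable set `B` of the points that `E n` relates to all their
neighbours has finite clusters; a clopen approximation `U_A` of `B` need not have, but the points
at which the clusters of `B` are exhausted by words of length `N`, and near which `U_A` and `B`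
agree, have clusters in `U_A` exhausted in the same way. -/
theorem exists_bounded_clusters_of_measure {ν : Measure (Ultrafilter X)} [IsProbabilityMeasure ν]
    [ν.Regular] (hinv : ∀ g : Γ, ν.map (fun ω => g • ω) = ν)
    (hν : IsHyperfiniteMeasureAction Γ ν) {ε : ℝ} (hε : 0 < ε) :
    ∃ Y : Set X, ν.real (betaSet Y) < ε ∧ ∃ K : ℕ, 0 < K ∧
      ∀ x ∈ Yᶜ, (cluster S Yᶜ x).encard ≤ K := by
  obtain ⟨E, hmono, hmeas, hfin, hae⟩ := hν
  obtain ⟨e, he0, heε⟩ : ∃ e : ENNReal, 0 < e ∧ e + e + e ≤ ENNReal.ofReal ε := by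
    refine ⟨ENNReal.ofReal (ε / 3), by simpa using hε, ?_⟩
    rw [← ENNReal.ofReal_add (by positivity) (by positivity),
      ← ENNReal.ofReal_add (by positivity) (by positivity)]
    exact ENNReal.ofReal_le_ofReal (by linarith)
  let B : ℕ → Set (Ultrafilter X) := fun n => {ω | ∀ s ∈ S, (E n) ω (s • ω)}
  have hBmeas : ∀ n, MeasurableSet (B n) := by
    intro n
    have : B n = ⋂ s ∈ S, (fun ω => (ω, s • ω)) ⁻¹' {p : Ultrafilter X × Ultrafilter X |
        (E n) p.1 p.2} := by
      ext ω
      simp [B]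
    rw [this]
    refine Finset.measurableSet_biInter S fun s _ => ?_
    have hc : Continuous fun ω : Ultrafilter X => (ω, s • ω) :=
      continuous_id.prodMk (continuous_smul_beta s)
    exact hc.borel_measurable (hmeas n)
  have hBev : ∀ᵐ ω ∂ν, ∀ᶠ n in atTop, ω ∈ B n := by
    filter_upwards [hae] with ω hω
    refine (Filter.eventually_all_finset S).2 fun s _ => ?_
    obtain ⟨n, hn⟩ := (hω (s • ω)).1 ⟨s, rfl⟩
    exact eventually_atTop.2 ⟨n, fun m hm => hmono hm hn⟩
  obtain ⟨n, hn⟩ := exists_measure_compl_lt ν hBmeas hBev he0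
  have hclus : ∀ ω, (cluster S (B n) ω).Finite := by
    refine fun ω => (hfin n ω).subset fun b hb => ?_
    induction hb with
    | refl => exact (E n).refl ω
    | tail _ h ih =>
      obtain ⟨hb, _, s, hs, rfl⟩ := h
      exact (E n).trans ih (hb s hs)
  obtain ⟨N, hN⟩ := exists_measure_compl_lt ν
    (fun N => measurableSet_exhaustedBy (S := S) (hBmeas n) N)
    (Eventually.of_forall fun ω => eventually_atTop.2 (exists_exhaustedBy_of_finite (hclus ω))) he0
  set T := (wordBall_finite S (N + 1)).toFinset with hT
  obtain ⟨A, hA⟩ := exists_betaSet_symmDiff_lt ν (hBmeas n) (e := e / T.card)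
    (ENNReal.div_pos he0.ne' (ENNReal.natCast_ne_top _)).ne'
  have hD : MeasurableSet (symmDiff (B n) (betaSet A)) :=
    (hBmeas n).symmDiff (measurableSet_betaSet A)
  refine ⟨{x | x ∈ A ∧ ExhaustedBy S N A x}ᶜ, ?_, (wordBall_finite S N).toFinset.card + 1,
    Nat.succ_pos _, ?_⟩
  · have hsub : betaSet {x | x ∈ A ∧ ExhaustedBy S N A x}ᶜ ⊆
        ((B n)ᶜ ∪ {ω | ExhaustedBy S N (B n) ω}ᶜ) ∪
          ⋃ g ∈ T, (fun ω => g • ω) ⁻¹' symmDiff (B n) (betaSet A) := by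
      intro ω hω
      by_contra hnot
      simp only [Set.mem_union, not_or, Set.mem_compl_iff, not_not, Set.mem_iUnion, not_exists,
        hT, Set.Finite.mem_toFinset, Set.mem_preimage, Set.mem_symmDiff, not_and] at hnot
      obtain ⟨⟨h1, h2⟩, h3⟩ := hnot
      have hagree : ∀ g ∈ wordBall S (N + 1), g • ω ∈ B n ↔ g • ω ∈ betaSet A :=
        fun g hg => ⟨(h3 g hg).1, (h3 g hg).2⟩
      have hωA : ω ∈ betaSet A := by simpa [h1] using hagree 1 ⟨[], by simp, rfl⟩
      have hex : ∀ᶠ x in (ω : Filter X), ExhaustedBy S N A x :=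
        exhaustedBy_betaSet.1 ((exhaustedBy_congr hagree).1 h2)
      exact Ultrafilter.compl_mem_iff_notMem.1 hω (inter_mem hωA hex)
    have hlt : ν (betaSet {x | x ∈ A ∧ ExhaustedBy S N A x}ᶜ) < ENNReal.ofReal ε := by
      calc _ ≤ _ := measure_mono hsub
        _ ≤ ν (B n)ᶜ + ν {ω | ExhaustedBy S N (B n) ω}ᶜ +
            ∑ g ∈ T, ν ((fun ω => g • ω) ⁻¹' symmDiff (B n) (betaSet A)) :=
          (measure_union_le _ _).trans
            (add_le_add (measure_union_le _ _) (measure_biUnion_finset_le _ _))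
        _ ≤ ν (B n)ᶜ + ν {ω | ExhaustedBy S N (B n) ω}ᶜ + e := by
          gcongr
          calc _ ≤ ∑ g ∈ T, e / T.card := Finset.sum_le_sum fun g _ => by
                rw [measure_preimage_smul_beta hinv g hD]
                exact hA.le
            _ = T.card * (e / T.card) := by rw [Finset.sum_const, nsmul_eq_mul]
            _ ≤ e := ENNReal.mul_div_le
        _ < e + e + e := by
          refine ENNReal.add_lt_add_right ?_ (ENNReal.add_lt_add hn hN)
          rintro rfl
          simp at heε
        _ ≤ _ := heε
    rwa [measureReal_def, ← ENNReal.lt_ofReal_iff_toReal_lt (measure_ne_top _ _)]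
  · intro x hx
    rw [compl_compl] at hx ⊢
    refine (Set.encard_le_encard (cluster_mono (fun y hy => hy.1) x)).trans
      (hx.2.encard_le.trans ?_)
    exact_mod_cast Nat.le_succ _

end MeanOfMeasure

/-! ### The measure on `βX` of an invariant mean -/

section Mean

variable {Γ X : Type*} [Group Γ] [MulAction Γ X] {S : Finset Γ} {μ : Set X → ℝ}

namespace IsInvariantMean

theorem nonneg (hμ : IsInvariantMean Γ μ) (A : Set X) : 0 ≤ μ A := (hμ.mem_Icc A).1

theorem empty (hμ : IsInvariantMean Γ μ) : μ ∅ = 0 := by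
  have := hμ.union ∅ ∅ (Set.disjoint_empty _)
  rw [Set.union_empty] at this
  linarith

theorem inter_add_diff (hμ : IsInvariantMean Γ μ) (A B : Set X) : μ (A ∩ B) + μ (A \ B) = μ A := by
  rw [← hμ.union (A ∩ B) (A \ B) disjoint_inf_sdiff, Set.inter_union_sdiff]

theorem mono (hμ : IsInvariantMean Γ μ) {A B : Set X} (h : A ⊆ B) : μ A ≤ μ B := by
  have := hμ.inter_add_diff B A
  rw [Set.inter_eq_right.2 h] at this
  linarith [hμ.nonneg (B \ A)]

theorem union_le (hμ : IsInvariantMean Γ μ) (A B : Set X) : μ (A ∪ B) ≤ μ A + μ B := by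
  rw [← Set.union_sdiff_self, hμ.union _ _ Set.disjoint_sdiff_right]
  linarith [hμ.mono (Set.sdiff_subset : B \ A ⊆ B)]

theorem compl (hμ : IsInvariantMean Γ μ) (A : Set X) : μ Aᶜ = 1 - μ A := by
  have := hμ.union A Aᶜ disjoint_compl_right
  rw [Set.union_compl_self, hμ.univ] at this
  linarith

theorem preimage (hμ : IsInvariantMean Γ μ) (g : Γ) (A : Set X) : μ {x | g • x ∈ A} = μ A := by
  rw [← hμ.invariant g]
  congr 1
  ext x
  exact ⟨fun ⟨y, hy, h⟩ => h ▸ hy, fun hx => ⟨g⁻¹ • x, by simpa using hx, smul_inv_smul g x⟩⟩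

/-- The value of the content of a mean on a compact set: the infimum of the means of the
clopen sets around it. -/
noncomputable def contentFun (hμ : IsInvariantMean Γ μ)
    (K : TopologicalSpace.Compacts (Ultrafilter X)) : NNReal :=
  ⨅ A : {A : Set X // (K : Set (Ultrafilter X)) ⊆ betaSet A}, ⟨μ A, hμ.nonneg A⟩

theorem contentFun_le (hμ : IsInvariantMean Γ μ) {K : TopologicalSpace.Compacts (Ultrafilter X)}
    {A : Set X} (h : (K : Set (Ultrafilter X)) ⊆ betaSet A) :
    hμ.contentFun K ≤ ⟨μ A, hμ.nonneg A⟩ :=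
  ciInf_le (OrderBot.bddBelow _)
    (⟨A, h⟩ : {A : Set X // (K : Set (Ultrafilter X)) ⊆ betaSet A})

instance (K : TopologicalSpace.Compacts (Ultrafilter X)) :
    Nonempty {A : Set X // (K : Set (Ultrafilter X)) ⊆ betaSet A} :=
  ⟨⟨Set.univ, fun _ _ => univ_mem⟩⟩

/-- The content on `βX` that a mean on `X` induces. -/
noncomputable def content (hμ : IsInvariantMean Γ μ) : Content (Ultrafilter X) where
  toFun := hμ.contentFun
  mono' K₁ K₂ h := le_ciInf fun A => hμ.contentFun_le (h.trans A.2)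
  sup_le' K₁ K₂ := by
    refine NNReal.le_iInf_add_iInf fun A₁ A₂ => ?_
    have h : ((K₁ ⊔ K₂ : TopologicalSpace.Compacts _) : Set (Ultrafilter X)) ⊆
        betaSet ((A₁ : Set X) ∪ A₂) := by
      rw [betaSet_union]
      exact Set.union_subset_union A₁.2 A₂.2
    refine (hμ.contentFun_le h).trans ?_
    exact hμ.union_le A₁ A₂
  sup_disjoint' K₁ K₂ hdisj h₁ h₂ := by
    apply le_antisymm
    · refine NNReal.le_iInf_add_iInf fun A₁ A₂ => ?_
      have h : ((K₁ ⊔ K₂ : TopologicalSpace.Compacts _) : Set (Ultrafilter X)) ⊆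
          betaSet ((A₁ : Set X) ∪ A₂) := by
        rw [betaSet_union]
        exact Set.union_subset_union A₁.2 A₂.2
      refine (hμ.contentFun_le h).trans ?_
      exact hμ.union_le A₁ A₂
    · refine le_ciInf fun A => ?_
      obtain ⟨C, hC1, hC2⟩ := exists_betaSet_between h₁ h₂.isOpen_compl
        (Set.subset_compl_iff_disjoint_right.2 hdisj)
      have hA : (K₁ : Set (Ultrafilter X)) ⊆ betaSet (A : Set X) ∧
          (K₂ : Set (Ultrafilter X)) ⊆ betaSet (A : Set X) := Set.union_subset_iff.1 A.2
      have e1 : (K₁ : Set (Ultrafilter X)) ⊆ betaSet ((A : Set X) ∩ C) :=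
        fun ω hω => inter_mem (hA.1 hω) (hC1 hω)
      have e2 : (K₂ : Set (Ultrafilter X)) ⊆ betaSet ((A : Set X) \ C) := fun ω hω =>
        inter_mem (hA.2 hω) (Ultrafilter.compl_mem_iff_notMem.2 fun h => hC2 h hω)
      refine (add_le_add (hμ.contentFun_le e1) (hμ.contentFun_le e2)).trans ?_
      exact (hμ.inter_add_diff A C).le

theorem content_measure_betaSet (hμ : IsInvariantMean Γ μ) (A : Set X) :
    hμ.content.measure (betaSet A) = ENNReal.ofReal (μ A) := by
  have hc := isClopen_betaSet A
  rw [Content.measure_apply _ (measurableSet_betaSet A), Content.outerMeasure_of_isOpen _ _ hc.isOpen,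
    Content.innerContent_of_isCompact _ hc.isClosed.isCompact hc.isOpen]
  change ((hμ.contentFun _ : NNReal) : ENNReal) = _
  rw [ENNReal.ofReal_eq_coe_nnreal (hμ.nonneg A)]
  congr 1
  refine le_antisymm (hμ.contentFun_le (le_refl _)) (le_ciInf fun A' => ?_)
  exact hμ.mono fun x hx => A'.2 (show (pure x : Ultrafilter X) ∈ betaSet A from hx)

instance : ContinuousConstSMul Γ (Ultrafilter X) := ⟨continuous_smul_beta⟩

theorem content_measure_map (hμ : IsInvariantMean Γ μ) (g : Γ) :
    hμ.content.measure.map (fun ω => g • ω) = hμ.content.measure := by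
  ext B hB
  have hm := (continuous_smul_beta (X := X) g).measurable
  rw [Measure.map_apply hm hB, Content.measure_apply _ hB, Content.measure_apply _ (hm hB)]
  refine hμ.content.outerMeasure_preimage (Homeomorph.smul g) (fun K => ?_) B
  change ((hμ.contentFun _ : NNReal) : ENNReal) = ((hμ.contentFun _ : NNReal) : ENNReal)
  congr 1
  apply le_antisymm
  · refine le_ciInf fun A => ?_
    have h : ((K.map _ (Homeomorph.smul g).continuous : TopologicalSpace.Compacts (Ultrafilter X)) :
        Set (Ultrafilter X)) ⊆ betaSet {x | g⁻¹ • x ∈ (A : Set X)} := by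
      rintro _ ⟨ω, hω, rfl⟩
      rw [← smul_mem_betaSet]
      simpa using A.2 hω
    refine (hμ.contentFun_le h).trans ?_
    exact (hμ.preimage g⁻¹ A).le
  · refine le_ciInf fun A => ?_
    have h : (K : Set (Ultrafilter X)) ⊆ betaSet {x | g • x ∈ (A : Set X)} :=
      fun ω hω => A.2 ⟨ω, hω, rfl⟩
    refine (hμ.contentFun_le h).trans ?_
    exact (hμ.preimage g A).le

end IsInvariantMean

/-! ### From an invariant mean to a hyperfinite extended action -/

/-- The equivalence relation on `Z` whose classes are the clusters in `W`. -/
def clusterSetoid {Z : Type*} [MulAction Γ Z] (hS : ∀ s ∈ S, s⁻¹ ∈ S) (W : Set Z) : Setoid Z where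
  r a b := b ∈ cluster S W a
  iseqv := ⟨mem_cluster_self, cluster_symm hS, Relation.ReflTransGen.trans⟩

theorem isClosed_pathIn {W : Set (Ultrafilter X)} (hW : IsClosed W) (l : List S) :
    IsClosed {ω | PathIn W l ω} := by
  induction l with
  | nil => simp [PathIn]
  | cons s l ih =>
    have hs := continuous_smul_beta (X := X) (s : Γ)
    exact hW.inter ((hW.preimage hs).inter (ih.preimage hs))

theorem measurableSet_clusterSetoid (hS : ∀ s ∈ S, s⁻¹ ∈ S) {W : Set (Ultrafilter X)}
    (hW : IsClosed W) : MeasurableSet[borel (Ultrafilter X × Ultrafilter X)]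
      {p : Ultrafilter X × Ultrafilter X | (clusterSetoid hS W) p.1 p.2} := by
  have hset : {p : Ultrafilter X × Ultrafilter X | (clusterSetoid hS W) p.1 p.2} =
      ⋃ l : List S, {p | PathIn W l p.1 ∧ wordEval l • p.1 = p.2} := by
    ext p
    rw [Set.mem_iUnion]
    exact mem_cluster_iff_word
  rw [hset]
  let : MeasurableSpace (Ultrafilter X × Ultrafilter X) := borel _
  have : BorelSpace (Ultrafilter X × Ultrafilter X) := ⟨rfl⟩
  refine MeasurableSet.iUnion fun l => IsClosed.measurableSet ?_
  exact ((isClosed_pathIn hW l).preimage continuous_fst).inter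
    (isClosed_eq ((continuous_smul_beta _).comp continuous_fst) continuous_snd)

theorem smul_mem_cluster {Z : Type*} [MulAction Γ Z] {W : Set Z} {z : Z} {l : List S}
    (h : ∀ g ∈ wordBall S l.length, g • z ∈ W) : wordEval l • z ∈ cluster S W z := by
  refine mem_cluster_iff_word.2 ⟨l, ?_, rfl⟩
  refine (pathIn_congr (W' := Set.univ) (fun g hg => ?_) le_rfl).2 ?_
  · simp [h g hg]
  · clear h
    induction l generalizing z with
    | nil => trivial
    | cons s l ih => exact ⟨trivial, trivial, ih⟩

theorem exists_wordEval_eq (hS : ∀ s ∈ S, s⁻¹ ∈ S) (hgen : Subgroup.closure (S : Set Γ) = ⊤)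
    (g : Γ) : ∃ l : List S, wordEval l = g := by
  -- The words spell the cluster of `1` for the action of `Γ` on itself, which is everything.
  have key : ∀ h : Γ, h ∈ cluster S (Set.univ : Set Γ) 1 := by
    intro h
    have hh : h ∈ Subgroup.closure (S : Set Γ) := hgen ▸ Subgroup.mem_top h
    induction hh using Subgroup.closure_induction_left with
    | one => exact mem_cluster_self _
    | mul_left s hs y _ ih =>
      exact mem_cluster_of_smul_mem (s := s) hs trivial ih trivial
    | inv_mul_cancel s hs y _ ih =>
      exact mem_cluster_of_smul_mem (s := s⁻¹) (hS s hs) trivial ih trivial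
  obtain ⟨l, -, hl⟩ := mem_cluster_iff_word.1 (key g)
  exact ⟨l, by simpa using hl⟩

/-- The ascending relations are given by the clusters of the closed sets
`Z n = ⋂ m ≥ n, betaSet (Y m)ᶜ`, where the means of the `Y m` are summable. -/
theorem isHyperfiniteSetAction_of_mean (hS : ∀ s ∈ S, s⁻¹ ∈ S)
    (hgen : Subgroup.closure (S : Set Γ) = ⊤) (hμ : IsInvariantMean Γ μ)
    (hhyp : ∀ ε : ℝ, 0 < ε → ∃ Y : Set X, μ Y < ε ∧ ∃ K : ℕ, 0 < K ∧
      ∀ x ∈ Yᶜ, (cluster S Yᶜ x).encard ≤ K) : IsHyperfiniteSetAction Γ X := by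
  have hcover : ∀ g : Γ, ∃ l : List S, wordEval l = g := exists_wordEval_eq hS hgen
  have : Countable Γ := Function.Surjective.countable hcover
  have hprob : IsProbabilityMeasure hμ.content.measure := ⟨by
    have : (Set.univ : Set (Ultrafilter X)) = betaSet Set.univ :=
      (Set.eq_univ_of_forall fun _ => univ_mem).symm
    rw [this, hμ.content_measure_betaSet, hμ.univ, ENNReal.ofReal_one]⟩
  refine ⟨hμ.content.measure, hprob, inferInstance, hμ.content_measure_map, ?_⟩
  set ν := hμ.content.measure with hν
  choose Y hY K hK0 hK using fun n : ℕ => hhyp ((1 / 2 : ℝ) ^ n) (by positivity)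
  let Z : ℕ → Set (Ultrafilter X) := fun n => ⋂ m ≥ n, betaSet (Y m)ᶜ
  have hZmono : Monotone Z := fun n n' h =>
    Set.iInter_mono fun m => Set.iInter_mono' fun hm => ⟨h.trans hm, le_rfl⟩
  have hZclosed : ∀ n, IsClosed (Z n) := fun n =>
    isClosed_iInter fun m => isClosed_iInter fun _ => (isClopen_betaSet _).isClosed
  have hfin : ∀ n ω, (cluster S (Z n) ω).Finite := by
    intro n ω
    by_cases hω : ω ∈ Z n
    · have hsub : Z n ⊆ betaSet (Y n)ᶜ := Set.iInter₂_subset n le_rfl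
      refine Set.Finite.subset ?_ (cluster_mono hsub ω)
      exact Set.finite_of_encard_le_coe (encard_cluster_betaSet_le (hK n) (hsub hω))
    · refine (Set.finite_singleton ω).subset fun b hb => ?_
      rcases Relation.ReflTransGen.cases_head hb with h | ⟨c, h, _⟩
      · exact h.symm
      · exact absurd h.1 hω
  have hev : ∀ᵐ ω ∂ν, ∀ᶠ n in atTop, ω ∈ Z n := by
    -- Borel–Cantelli: almost every point lies in finitely many `betaSet (Y m)` only.
    have hsum : ∑' m, ν (betaSet (Y m)) ≠ ⊤ := by
      refine ne_top_of_le_ne_top ?_ (ENNReal.tsum_le_tsum fun m =>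
        (hμ.content_measure_betaSet (Y m)).le.trans (ENNReal.ofReal_le_ofReal (hY m).le))
      rw [← ENNReal.ofReal_tsum_of_nonneg (fun m => by positivity) summable_geometric_two]
      exact ENNReal.ofReal_ne_top
    filter_upwards [ae_eventually_notMem hsum] with ω hω
    obtain ⟨n, hn⟩ := eventually_atTop.1 hω
    refine eventually_atTop.2 ⟨n, fun m hm => Set.mem_iInter₂.2 fun k hk => ?_⟩
    exact Ultrafilter.compl_mem_iff_notMem.2 (hn k (hm.trans hk))
  have hall : ∀ᵐ ω ∂ν, ∀ g : Γ, ∀ᶠ n in atTop, g • ω ∈ Z n := by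
    refine ae_all_iff.2 fun g => ?_
    have hg := (continuous_smul_beta (X := X) g).measurable
    have := hμ.content_measure_map g
    rw [← hν] at this
    rw [← this] at hev
    exact ae_of_ae_map hg.aemeasurable hev
  refine ⟨fun n => clusterSetoid hS (Z n), fun n n' h a b hab => cluster_mono (hZmono h) a hab,
    fun n => measurableSet_clusterSetoid hS (hZclosed n), hfin, ?_⟩
  filter_upwards [hall] with ω hω w
  constructor
  · rintro ⟨g, rfl⟩
    obtain ⟨l, rfl⟩ := hcover g
    obtain ⟨n, hn⟩ := ((eventually_all_finite (wordBall_finite S l.length)).2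
      fun g _ => hω g).exists
    exact ⟨n, smul_mem_cluster hn⟩
  · rintro ⟨n, hn⟩
    obtain ⟨l, -, rfl⟩ := mem_cluster_iff_word.1 hn
    exact ⟨_, rfl⟩

end Mean

/-! ### Hyperfinite sequences of induced subgraphs, in terms of clusters -/

section HyperfiniteSeq

variable {Γ X : Type*} [Group Γ] [MulAction Γ X] {S : Finset Γ}

theorem induce_induce_componentsBoundedBy_iff (hS : ∀ s ∈ S, s⁻¹ ∈ S) {F : Set X} {Y : Finset F}
    {K : ℕ} {A : Set X} (hA : ∀ x, x ∈ A ↔ ∃ h : x ∈ F, (⟨x, h⟩ : F) ∉ Y) :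
    (((schreierGraph X S).induce F).induce {v | v ∉ Y}).ComponentsBoundedBy K ↔
      ∀ x ∈ A, (cluster S A x).encard ≤ K := by
  constructor
  · intro h x hx
    obtain ⟨hxF, hxY⟩ := (hA x).1 hx
    refine encard_cluster_le_of_componentsBoundedBy
      (fun v : {v : F | v ∉ Y} => ((v : F) : X)) ?_ h ⟨⟨x, hxF⟩, hxY⟩
    rintro u y ⟨-, hy, s, hs, rfl⟩
    obtain ⟨hyF, hyY⟩ := (hA _).1 hy
    refine ⟨⟨⟨_, hyF⟩, hyY⟩, rfl, ?_⟩
    by_cases heq : ((u : F) : X) = s • ((u : F) : X)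
    · have : u = ⟨⟨s • ((u : F) : X), hyF⟩, hyY⟩ := Subtype.ext (Subtype.ext heq)
      rw [← this]
    · refine SimpleGraph.Adj.reachable ?_
      rw [SimpleGraph.comap_adj, SimpleGraph.comap_adj]
      exact (schreierGraph_adj hS).2 ⟨heq, s, hs, rfl⟩
  · intro h
    have hmem : ∀ v : {v : F | v ∉ Y}, ((v : F) : X) ∈ A := fun v => (hA _).2 ⟨v.1.2, v.2⟩
    refine componentsBoundedBy_of_cluster (S := S) (A := A)
      (fun v : {v : F | v ∉ Y} => ((v : F) : X))
      (Subtype.val_injective.comp Subtype.val_injective) ?_ fun v => h v (hmem v)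
    intro u v huv
    rw [SimpleGraph.comap_adj, SimpleGraph.comap_adj] at huv
    exact ⟨hmem u, hmem v, ((schreierGraph_adj hS).1 huv).2⟩

theorem encard_neighborSet_le (hS : ∀ s ∈ S, s⁻¹ ∈ S) {F : Set X} (v : F) :
    (((schreierGraph X S).induce F).neighborSet v).encard ≤ S.card := by
  have h1 : (((schreierGraph X S).induce F).neighborSet v).encard ≤
      ((fun s : Γ => s • (v : X)) '' (S : Set Γ)).encard := by
    refine Set.encard_le_encard_of_injOn (f := Subtype.val) ?_ Subtype.val_injective.injOn
    intro w hw
    rw [SimpleGraph.mem_neighborSet, SimpleGraph.comap_adj] at hw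
    obtain ⟨-, s, hs, h⟩ := (schreierGraph_adj hS).1 hw
    exact ⟨s, hs, h⟩
  refine h1.trans ((Set.encard_image_le _ _).trans ?_)
  rw [Set.encard_coe_eq_coe_finsetCard]

theorem isHyperfiniteSeq_induce_iff (hS : ∀ s ∈ S, s⁻¹ ∈ S) (F : ℕ → Finset X) :
    IsHyperfiniteSeq (fun n => (schreierGraph X S).induce {x | x ∈ F n}) ↔
      ∀ ε : ℝ, 0 < ε → ∃ K : ℕ, 0 < K ∧ ∀ n, ∃ Y : Finset X, Y ⊆ F n ∧
        (Y.card : ℝ) < ε * (F n).card ∧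
          ∀ x ∈ {x | x ∈ F n ∧ x ∉ Y}, (cluster S {x | x ∈ F n ∧ x ∉ Y} x).encard ≤ K := by
  classical
  have hcard : ∀ n, Fintype.card {x | x ∈ F n} = (F n).card := fun n =>
    (Fintype.card_congr (Equiv.refl _)).trans (Fintype.card_coe (F n))
  constructor
  · rintro ⟨-, h⟩ ε hε
    obtain ⟨K, hK0, hK⟩ := h ε hε
    refine ⟨K, hK0, fun n => ?_⟩
    obtain ⟨Y, hY, hb⟩ := hK n
    refine ⟨Y.map (Function.Embedding.subtype _), ?_, ?_, ?_⟩
    · intro x hx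
      obtain ⟨v, -, rfl⟩ := Finset.mem_map.1 hx
      exact v.2
    · rw [Finset.card_map]
      rwa [hcard] at hY
    · refine (induce_induce_componentsBoundedBy_iff hS (F := {x | x ∈ F n}) fun x => ?_).1 hb
      rw [Set.mem_ofPred_eq, Finset.mem_map]
      refine ⟨fun h => ⟨h.1, fun hY => h.2 ⟨_, hY, rfl⟩⟩, fun ⟨h1, h2⟩ => ⟨h1, ?_⟩⟩
      rintro ⟨v, hv, rfl⟩
      exact h2 hv
  · intro h
    refine ⟨⟨S.card, fun n v => encard_neighborSet_le hS v⟩, fun ε hε => ?_⟩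
    obtain ⟨K, hK0, hK⟩ := h ε hε
    refine ⟨K, hK0, fun n => ?_⟩
    obtain ⟨Y, hYF, hY, hb⟩ := hK n
    refine ⟨Finset.univ.filter fun v => (v : X) ∈ Y, ?_, ?_⟩
    · rw [hcard]
      refine lt_of_le_of_lt ?_ hY
      refine Nat.cast_le.2 (Finset.card_le_card_of_injOn Subtype.val ?_
        Subtype.val_injective.injOn)
      intro v hv
      simpa using hv
    · refine (induce_induce_componentsBoundedBy_iff hS (F := {x | x ∈ F n}) fun x => ?_).2 hb
      simp

end HyperfiniteSeq

/-! ### From a hyperfinite Følner sequence to an invariant mean -/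

section FolnerMean

variable {Γ X : Type*} [Group Γ] [MulAction Γ X] {S : Finset Γ}

theorem edgeBoundary_subset (hS : ∀ s ∈ S, s⁻¹ ∈ S) (F : Finset X) :
    {p : X × X | p.1 ∈ F ∧ p.2 ∉ F ∧ (schreierGraph X S).Adj p.1 p.2} ⊆
      ⋃ s ∈ S, (fun x => (x, s • x)) '' {x | x ∈ F ∧ s • x ∉ F} := by
  rintro ⟨x, y⟩ ⟨hx, hy, h⟩
  obtain ⟨-, s, hs, h'⟩ := (schreierGraph_adj hS).1 h
  obtain rfl : s • x = y := h'
  exact Set.mem_iUnion₂.2 ⟨s, hs, x, ⟨hx, hy⟩, rfl⟩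

theorem edgeBoundary_finite (hS : ∀ s ∈ S, s⁻¹ ∈ S) (F : Finset X) :
    {p : X × X | p.1 ∈ F ∧ p.2 ∉ F ∧ (schreierGraph X S).Adj p.1 p.2}.Finite := by
  refine Set.Finite.subset (Set.Finite.biUnion S.finite_toSet fun s _ => ?_)
    (edgeBoundary_subset hS F)
  exact (F.finite_toSet.subset fun x hx => hx.1).image _

theorem ncard_exit_le (hS : ∀ s ∈ S, s⁻¹ ∈ S) (F : Finset X) {s : Γ} (hs : s ∈ S) :
    ({x | x ∈ F ∧ s • x ∉ F}.ncard : ℝ) ≤ (schreierGraph X S).isoConst F * F.card := by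
  rcases F.eq_empty_or_nonempty with rfl | hF
  · simp
  have hpos : (0 : ℝ) < F.card := by exact_mod_cast hF.card_pos
  rw [SimpleGraph.isoConst, div_mul_cancel₀ _ hpos.ne', Nat.cast_le]
  refine Set.ncard_le_ncard_of_injOn (fun x => (x, s • x)) ?_ ?_ (edgeBoundary_finite hS F)
  · rintro x ⟨hx, hsx⟩
    refine ⟨hx, hsx, (schreierGraph_adj hS).2 ⟨fun h => hsx ?_, s, hs, rfl⟩⟩
    rwa [← show x = s • x from h]
  · intro x _ y _ h
    exact congrArg Prod.fst h

theorem ncard_smul_inter_le (hS : ∀ s ∈ S, s⁻¹ ∈ S) (F : Finset X) {s : Γ} (hs : s ∈ S)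
    (A : Set X) : ((((fun x => s • x) '' A) ∩ F).ncard : ℝ) ≤
      (A ∩ F).ncard + (schreierGraph X S).isoConst F * F.card := by
  refine le_trans ?_ (add_le_add le_rfl (ncard_exit_le hS F (hS s hs)))
  have hfin : {x | x ∈ F ∧ s⁻¹ • x ∉ F}.Finite := F.finite_toSet.subset fun x hx => hx.1
  have hsub : (((fun x => s • x) '' A) ∩ F) ⊆
      (fun x => s • x) '' (A ∩ F) ∪ {x | x ∈ F ∧ s⁻¹ • x ∉ F} := by
    rintro _ ⟨⟨x, hx, rfl⟩, hF⟩
    by_cases hxF : x ∈ F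
    · exact Or.inl ⟨x, ⟨hx, hxF⟩, rfl⟩
    · exact Or.inr ⟨hF, by simpa using hxF⟩
  have h1 := Set.ncard_le_ncard hsub (((F.finite_toSet.inter_of_right A).image _).union hfin)
  have h2 := Set.ncard_union_le ((fun x => s • x) '' (A ∩ F)) {x | x ∈ F ∧ s⁻¹ • x ∉ F}
  have h3 := Set.ncard_image_le (f := fun x => s • x) (F.finite_toSet.inter_of_right A)
  exact_mod_cast h1.trans (h2.trans (add_le_add_left h3 _))

/-- The densities along a Følner sequence, in the limit along a fixed nonprincipal ultrafilter, form
an invariant mean. -/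
theorem exists_mean_of_isFolnerSeq (hS : ∀ s ∈ S, s⁻¹ ∈ S)
    (hgen : Subgroup.closure (S : Set Γ) = ⊤) {F : ℕ → Finset X}
    (hF : (schreierGraph X S).IsFolnerSeq F) :
    ∃ μ : Set X → ℝ, IsInvariantMean Γ μ ∧ ∀ A : Set X,
      Tendsto (fun n => ((A ∩ F n).ncard : ℝ) / (F n).card) (hyperfilter ℕ : Filter ℕ)
        (𝓝 (μ A)) := by
  have hpos : ∀ n, (0 : ℝ) < (F n).card := fun n => by exact_mod_cast (hF.1 n).card_pos
  have hfin : ∀ (A : Set X) n, (A ∩ F n).Finite := fun A n => (F n).finite_toSet.inter_of_right A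
  have hex : ∀ A : Set X, ∃ c ∈ Set.Icc (0 : ℝ) 1,
      Tendsto (fun n => ((A ∩ F n).ncard : ℝ) / (F n).card) (hyperfilter ℕ : Filter ℕ) (𝓝 c) := by
    intro A
    refine isCompact_Icc.ultrafilter_le_nhds
      ((hyperfilter ℕ).map fun n => ((A ∩ F n).ncard : ℝ) / (F n).card) ?_
    rw [le_principal_iff]
    refine Filter.mem_map.2 (Filter.univ_mem' fun n => ⟨by positivity, ?_⟩)
    rw [div_le_one (hpos n), Nat.cast_le, ← Set.ncard_coe_finset]
    exact Set.ncard_le_ncard Set.inter_subset_right (F n).finite_toSet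
  choose μ hμ hlim using hex
  have hle : ∀ g : Γ, ∀ A : Set X, μ ((fun x => g • x) '' A) ≤ μ A := by
    intro g
    have hg : g ∈ Subgroup.closure (S : Set Γ) := hgen ▸ Subgroup.mem_top g
    have hstep : ∀ s ∈ S, ∀ A : Set X, μ ((fun x => s • x) '' A) ≤ μ A := by
      intro s hs A
      have hiso := hF.2.mono_left (Nat.hyperfilter_le_atTop)
      have hsum := (hlim A).add hiso
      rw [add_zero] at hsum
      refine le_of_tendsto_of_tendsto' (hlim _) hsum fun n => ?_
      rw [div_add' _ _ _ (hpos n).ne']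
      exact div_le_div_of_nonneg_right (ncard_smul_inter_le hS (F n) hs A) (hpos n).le
    have himg : ∀ (a b : Γ) (A : Set X),
        (fun x => (a * b) • x) '' A = (fun x => a • x) '' ((fun x => b • x) '' A) := by
      intro a b A
      simp only [Set.image_image, mul_smul]
    induction hg using Subgroup.closure_induction_left with
    | one => simp
    | mul_left s hs y _ ih => exact fun A => (himg s y A) ▸ (hstep s hs _).trans (ih A)
    | inv_mul_cancel s hs y _ ih =>
      exact fun A => (himg s⁻¹ y A) ▸ (hstep s⁻¹ (hS s hs) _).trans (ih A)
  refine ⟨μ, ⟨hμ, ?_, ?_, fun g A => le_antisymm (hle g A) ?_⟩, hlim⟩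
  · refine tendsto_nhds_unique (hlim _) (tendsto_const_nhds.congr fun n => ?_)
    rw [Set.univ_inter, Set.ncard_coe_finset, div_self (hpos n).ne']
  · intro A B hAB
    refine tendsto_nhds_unique (hlim _) (((hlim A).add (hlim B)).congr fun n => ?_)
    rw [← add_div, Set.union_inter_distrib_right, Set.ncard_union_eq
      (hAB.mono Set.inter_subset_left Set.inter_subset_left) (hfin A n) (hfin B n), Nat.cast_add]
  · have := hle g⁻¹ ((fun x => g • x) '' A)
    rwa [Set.image_image, show (fun x : X => g⁻¹ • g • x) = id from funext fun x =>
      inv_smul_smul g x, Set.image_id] at this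

theorem cluster_subset_of_no_exit {W Z : Set X} {x : X} (hx : x ∈ Z)
    (h : ∀ y ∈ Z, ∀ z, GenStep S W y z → z ∈ Z) : cluster S W x ⊆ cluster S Z x := by
  intro y hy
  have hyZ : y ∈ cluster S Z x ∧ y ∈ Z := by
    induction hy with
    | refl => exact ⟨mem_cluster_self _, hx⟩
    | tail _ hs ih =>
      have hz := h _ ih.2 _ hs
      exact ⟨Relation.ReflTransGen.tail ih.1 ⟨ih.2, hz, hs.2.2⟩, hz⟩
  exact hyZ.1

/-- If the sizes of the `F n` tend to infinity, there is a subsequence in which the `k`-th set is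
so large that all earlier sets and their neighbours, collected in `P k`, are a negligible part of
it. Removing `P k` from it makes the sets disjoint and pairwise non-adjacent. -/
theorem exists_sparse_subsequence {F : ℕ → Finset X}
    (hcard : ∀ N : ℕ, ∀ᶠ n in atTop, N ≤ (F n).card) :
    ∃ (φ : ℕ → ℕ) (P : ℕ → Finset X), (∀ k, k ≤ φ k) ∧ (∀ k, k * (P k).card ≤ (F (φ k)).card) ∧
      ∀ j k, j < k → ∀ x ∈ F (φ j), x ∈ P k ∧ ∀ s ∈ S, s • x ∈ P k := by
  classical
  have hex : ∀ (k : ℕ) (P : Finset X), ∃ n, k ≤ n ∧ k * P.card ≤ (F n).card := fun k P =>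
    ((eventually_ge_atTop k).and (hcard (k * P.card))).exists
  choose ψ hψ1 hψ2 using hex
  let P : ℕ → Finset X := fun k => Nat.rec ∅ (fun k P =>
    P ∪ (F (ψ k P) ∪ (S ×ˢ F (ψ k P)).image fun p => p.1 • p.2)) k
  have hP : ∀ k, P (k + 1) = P k ∪ (F (ψ k (P k)) ∪
    (S ×ˢ F (ψ k (P k))).image fun p => p.1 • p.2) := fun k => rfl
  have hmono : Monotone P := monotone_nat_of_le_succ fun k => by
    rw [hP]
    exact Finset.subset_union_left
  refine ⟨fun k => ψ k (P k), P, fun k => hψ1 _ _, fun k => hψ2 _ _, fun j k hjk x hx => ?_⟩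
  have hsub : P (j + 1) ⊆ P k := hmono hjk
  rw [hP] at hsub
  refine ⟨hsub (Finset.mem_union_right _ (Finset.mem_union_left _ hx)), fun s hs => hsub ?_⟩
  exact Finset.mem_union_right _ (Finset.mem_union_right _
    (Finset.mem_image.2 ⟨(s, x), Finset.mem_product.2 ⟨hs, hx⟩, rfl⟩))

theorem eventually_card_ge_of_isoConst_ne_zero {F : ℕ → Finset X}
    (hF : (schreierGraph X S).IsFolnerSeq F)
    (h0 : ∀ n, (schreierGraph X S).isoConst (F n) ≠ 0) (N : ℕ) :
    ∀ᶠ n in atTop, N ≤ (F n).card := by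
  filter_upwards [hF.2.eventually_lt_const (show (0 : ℝ) < 1 / (N + 1) by positivity)] with n hn
  have hpos : (0 : ℝ) < (F n).card := by exact_mod_cast (hF.1 n).card_pos
  have h1 : (1 : ℝ) / (F n).card ≤ (schreierGraph X S).isoConst (F n) := by
    refine div_le_div_of_nonneg_right ?_ hpos.le
    have := h0 n
    rw [SimpleGraph.isoConst, div_ne_zero_iff] at this
    exact_mod_cast Nat.one_le_iff_ne_zero.2 (by exact_mod_cast this.1)
  have h2 := (one_div_lt_one_div hpos (by positivity)).1 (h1.trans_lt hn)
  have h3 : N + 1 < (F n).card := by exact_mod_cast h2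
  omega

/-- If some `F n` has no boundary, the uniform mean on it will do. Otherwise the sizes of the `F n`
tend to infinity, and along a sparse subsequence the sets that witness hyperfiniteness for the
single `F n` glue to one subset of `X`. -/
theorem exists_mean_of_hyperfinite_folner (hS : ∀ s ∈ S, s⁻¹ ∈ S)
    (hgen : Subgroup.closure (S : Set Γ) = ⊤) {F : ℕ → Finset X}
    (hF : (schreierGraph X S).IsFolnerSeq F)
    (hhyp : ∀ ε : ℝ, 0 < ε → ∃ K : ℕ, 0 < K ∧ ∀ n, ∃ Y : Finset X, Y ⊆ F n ∧
        (Y.card : ℝ) < ε * (F n).card ∧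
          ∀ x ∈ {x | x ∈ F n ∧ x ∉ Y}, (cluster S {x | x ∈ F n ∧ x ∉ Y} x).encard ≤ K) :
    ∃ μ : Set X → ℝ, IsInvariantMean Γ μ ∧ ∀ ε : ℝ, 0 < ε → ∃ Y : Set X, μ Y < ε ∧
      ∃ K : ℕ, 0 < K ∧ ∀ x ∈ Yᶜ, (cluster S Yᶜ x).encard ≤ K := by
  by_cases h0 : ∃ n, (schreierGraph X S).isoConst (F n) = 0
  · obtain ⟨n, hn⟩ := h0
    obtain ⟨μ, hμ, hlim⟩ := exists_mean_of_isFolnerSeq hS hgen (F := fun _ => F n)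
      ⟨fun _ => hF.1 n, by simpa only [hn] using tendsto_const_nhds⟩
    refine ⟨μ, hμ, fun ε hε => ⟨(F n : Set X)ᶜ, ?_, (F n).card, (hF.1 n).card_pos, ?_⟩⟩
    · have h := hlim (F n : Set X)ᶜ
      simp only [Set.compl_inter_self, Set.ncard_empty, Nat.cast_zero, zero_div] at h
      rwa [tendsto_nhds_unique h tendsto_const_nhds]
    · intro x hx
      rw [compl_compl] at hx ⊢
      rw [← Set.encard_coe_eq_coe_finsetCard]
      exact Set.encard_le_encard (cluster_subset hx)
  · push Not at h0
    obtain ⟨φ, P, hφ, hP, hsparse⟩ := exists_sparse_subsequence (S := S)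
      (eventually_card_ge_of_isoConst_ne_zero hF h0)
    have hφtop : Tendsto φ atTop atTop := tendsto_atTop_mono hφ tendsto_id
    obtain ⟨μ, hμ, hlim⟩ := exists_mean_of_isFolnerSeq hS hgen (F := fun k => F (φ k))
      ⟨fun k => hF.1 _, hF.2.comp hφtop⟩
    refine ⟨μ, hμ, fun ε hε => ?_⟩
    obtain ⟨K, hK0, hK⟩ := hhyp (ε / 2) (half_pos hε)
    choose Y hYF hY hYK using hK
    let Z : ℕ → Set X := fun k => {x | x ∈ F (φ k) ∧ x ∉ P k ∧ x ∉ Y (φ k)}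
    refine ⟨(⋃ k, Z k)ᶜ, ?_, K, hK0, ?_⟩
    · have hbound : ∀ᶠ k : ℕ in (hyperfilter ℕ : Filter ℕ),
          ((((⋃ k, Z k)ᶜ ∩ F (φ k) : Set X).ncard : ℝ) / (F (φ k)).card) ≤
            1 / (k : ℝ) + ε / 2 := by
        refine Nat.hyperfilter_le_atTop ?_
        filter_upwards [eventually_gt_atTop 0] with k hk
        have hpos : (0 : ℝ) < (F (φ k)).card := by exact_mod_cast (hF.1 _).card_pos
        have hk' : (0 : ℝ) < k := by exact_mod_cast hk
        classical
        have hsub : ((⋃ k, Z k)ᶜ ∩ F (φ k) : Set X) ⊆ ((P k ∪ Y (φ k) : Finset X) : Set X) := by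
          rintro x ⟨hx, hxF⟩
          by_contra hnot
          rw [Finset.mem_coe, Finset.mem_union, not_or] at hnot
          exact hx (Set.mem_iUnion.2 ⟨k, hxF, hnot.1, hnot.2⟩)
        have h1 := Set.ncard_le_ncard hsub (Finset.finite_toSet _)
        rw [Set.ncard_coe_finset] at h1
        have h2 : ((((⋃ k, Z k)ᶜ ∩ F (φ k) : Set X).ncard : ℝ)) ≤
            (P k).card + (Y (φ k)).card := by
          exact_mod_cast h1.trans (Finset.card_union_le _ _)
        have h3 : (k : ℝ) * (P k).card ≤ (F (φ k)).card := by exact_mod_cast hP k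
        have h4 : ((P k).card : ℝ) ≤ 1 / k * (F (φ k)).card := by
          rw [one_div, le_inv_mul_iff₀ hk']
          exact h3
        rw [div_le_iff₀ hpos, add_mul]
        linarith [hY (φ k)]
      have hlim' : Tendsto (fun k : ℕ => 1 / (k : ℝ) + ε / 2) (hyperfilter ℕ : Filter ℕ)
          (𝓝 (0 + ε / 2)) :=
        (tendsto_one_div_atTop_nhds_zero_nat.mono_left Nat.hyperfilter_le_atTop).add_const _
      have := le_of_tendsto_of_tendsto (hlim _) hlim' hbound
      linarith
    · intro x hx
      rw [compl_compl] at hx ⊢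
      obtain ⟨k, hxk⟩ := Set.mem_iUnion.1 hx
      -- A move inside `⋃ k, Z k` cannot change the index, as `P` swallows the neighbours.
      have hno : ∀ y ∈ Z k, ∀ z, GenStep S (⋃ k, Z k) y z → z ∈ Z k := by
        rintro y hy z ⟨-, hz, s, hs, rfl⟩
        obtain ⟨j, hj⟩ := Set.mem_iUnion.1 hz
        rcases lt_trichotomy j k with h | rfl | h
        · refine absurd ?_ hy.2.1
          simpa using (hsparse j k h _ hj.1).2 s⁻¹ (hS s hs)
        · exact hj
        · exact absurd ((hsparse k j h _ hy.1).2 s hs) hj.2.1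
      have hsub : Z k ⊆ {x | x ∈ F (φ k) ∧ x ∉ Y (φ k)} := fun y hy => ⟨hy.1, hy.2.2⟩
      refine (Set.encard_le_encard ?_).trans (hYK (φ k) x (hsub hxk))
      exact (cluster_subset_of_no_exit hxk hno).trans (cluster_mono hsub x)

end FolnerMean

/-! ### Mass transport for invariant means -/

section MassTransport

variable {Γ X : Type*} [Group Γ] [MulAction Γ X] {S : Finset Γ} {μ : Set X → ℝ}

theorem IsInvariantMean.sum_fibers (hμ : IsInvariantMean Γ μ) {ι : Type*} (q : X → ι)
    (D : Set X) (s : Finset ι) : μ {x | x ∈ D ∧ q x ∈ s} = ∑ i ∈ s, μ {x | x ∈ D ∧ q x = i} := by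
  classical
  induction s using Finset.induction_on with
  | empty => simpa using hμ.empty
  | insert i s hi ih =>
    rw [Finset.sum_insert hi, ← ih, ← hμ.union]
    · congr 1
      ext x
      simp only [Finset.mem_insert, Set.mem_union, Set.mem_ofPred_eq]
      tauto
    · rw [Set.disjoint_left]
      rintro x ⟨-, rfl⟩ ⟨-, h⟩
      exact hi h

/-- A mean is positive on linear combinations of indicator functions. -/
theorem IsInvariantMean.sum_nonneg (hμ : IsInvariantMean Γ μ) {J : Type*} (s : Finset J)
    (a : J → ℝ) (D : J → Set X) (h : ∀ x, 0 ≤ ∑ j ∈ s, a j * (D j).indicator 1 x) :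
    0 ≤ ∑ j ∈ s, a j * μ (D j) := by
  classical
  -- On the set where `x` has the pattern `p x`, all indicator functions are constant.
  let p : X → Finset J := fun x => s.filter fun j => x ∈ D j
  have hmem : ∀ x, p x ∈ s.powerset := fun x => Finset.mem_powerset.2 (Finset.filter_subset _ _)
  have hD : ∀ j ∈ s, μ (D j) = ∑ q ∈ s.powerset, if j ∈ q then μ {x | p x = q} else 0 := by
    intro j hj
    have := hμ.sum_fibers p (D j) s.powerset
    simp only [hmem, and_true] at this
    refine Eq.trans this (Finset.sum_congr rfl fun q _ => ?_)
    split_ifs with hjq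
    · congr 1
      ext x
      refine and_iff_right_of_imp fun hx => ?_
      rw [← (show p x = q from hx)] at hjq
      exact (Finset.mem_filter.1 hjq).2
    · rw [← hμ.empty]
      congr 1
      refine Set.eq_empty_of_forall_notMem fun x hx => hjq ?_
      rw [← (show p x = q from hx.2)]
      exact Finset.mem_filter.2 ⟨hj, hx.1⟩
  rw [Finset.sum_congr rfl fun j hj => by rw [hD j hj, Finset.mul_sum], Finset.sum_comm]
  refine Finset.sum_nonneg fun q _ => ?_
  have hq : ∑ j ∈ s, a j * (if j ∈ q then μ {x | p x = q} else 0) =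
      (∑ j ∈ s, a j * if j ∈ q then 1 else 0) * μ {x | p x = q} := by
    rw [Finset.sum_mul]
    refine Finset.sum_congr rfl fun j _ => ?_
    split_ifs <;> ring
  rw [hq]
  rcases {x | p x = q}.eq_empty_or_nonempty with h0 | ⟨x, hx⟩
  · rw [h0, hμ.empty, mul_zero]
  · refine mul_nonneg ?_ (hμ.nonneg _)
    refine (h x).trans_eq (Finset.sum_congr rfl fun j hj => ?_)
    have : j ∈ q ↔ x ∈ D j := by
      rw [← (show p x = q from hx), Finset.mem_filter]
      exact and_iff_right hj
    simp only [this, Set.indicator_apply, Pi.one_apply]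

/-- Let a finite `T ⊆ Γ` connect any two points of a cluster of `A`. If a linear
combination of the sizes of `B i ∩ C` is nonnegative for every cluster `C` of `A`, then so is that
of the means of the `B i`: the mass of each point is transported to a representative of its
cluster, by elements of `T` that differ for distinct points of the cluster. -/
theorem IsInvariantMean.sum_nonneg_of_clusters (hS : ∀ s ∈ S, s⁻¹ ∈ S) (hμ : IsInvariantMean Γ μ)
    {A : Set X} {T : Finset Γ} (hT : ∀ x ∈ A, ∀ y ∈ cluster S A x, ∃ t ∈ T, t • x = y)
    {I : Type*} (s : Finset I) (a : I → ℝ) (B : I → Set X) (hB : ∀ i, B i ⊆ A)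
    (h : ∀ x ∈ A, 0 ≤ ∑ i ∈ s, a i * (B i ∩ cluster S A x).ncard) :
    0 ≤ ∑ i ∈ s, a i * μ (B i) := by
  classical
  let rep : X → X := fun x => (Quotient.mk (clusterSetoid hS A) x).out
  have hrep : ∀ x, x ∈ cluster S A (rep x) := fun x => Quotient.mk_out (s := clusterSetoid hS A) x
  have hrep_eq : ∀ x y, y ∈ cluster S A x → rep y = rep x := fun x y hy =>
    congrArg Quotient.out (Quotient.sound (s := clusterSetoid hS A) (cluster_symm hS hy))
  have hrepA : ∀ x ∈ A, rep x ∈ A := fun x hx => cluster_subset hx (cluster_symm hS (hrep x))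
  choose! τ hτT hτ using fun x (hx : x ∈ A) => hT (rep x) (hrepA x hx) x (hrep x)
  let D : I × Γ → Set X := fun p => {r | p.2 • r ∈ B p.1 ∧ τ (p.2 • r) = p.2}
  have hrepD : ∀ p r, r ∈ D p → rep (p.2 • r) = r := by
    rintro ⟨i, t⟩ r ⟨h1, h2⟩
    have := hτ _ (hB i h1)
    dsimp only at h1 h2 this
    rw [h2] at this
    exact smul_left_cancel t this
  have hμB : ∀ i, μ (B i) = ∑ t ∈ T, μ (D (i, t)) := by
    intro i
    have h1 := hμ.sum_fibers τ (B i) T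
    have h2 : {x | x ∈ B i ∧ τ x ∈ T} = B i :=
      Set.ext fun x => and_iff_left_of_imp fun hx => hτT x (hB i hx)
    rw [h2] at h1
    rw [h1]
    exact Finset.sum_congr rfl fun t _ => (hμ.preimage t {x | x ∈ B i ∧ τ x = t}).symm
  have hsum : ∑ i ∈ s, a i * μ (B i) = ∑ p ∈ s ×ˢ T, a p.1 * μ (D p) := by
    rw [Finset.sum_product]
    exact Finset.sum_congr rfl fun i _ => by rw [hμB, Finset.mul_sum]
  rw [hsum]
  refine hμ.sum_nonneg _ (fun p => a p.1) D fun r => ?_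
  rw [Finset.sum_product]
  by_cases hr : r ∈ A ∧ rep r = r
  · refine (h r hr.1).trans_eq (Finset.sum_congr rfl fun i _ => ?_)
    refine Eq.trans ?_ (Finset.mul_sum T (fun t => (D (i, t)).indicator (1 : X → ℝ) r) (a i))
    congr 1
    have himg : B i ∩ cluster S A r =
        (((T.filter fun t => r ∈ D (i, t)).image fun t => t • r : Finset X) : Set X) := by
      ext x
      rw [Finset.coe_image, Finset.coe_filter]
      constructor
      · rintro ⟨hx, hxr⟩
        have hxA := hB i hx
        have e : τ x • r = x := by
          rw [← hr.2, ← hrep_eq r x hxr]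
          exact hτ x hxA
        refine ⟨τ x, ⟨hτT x hxA, ?_, ?_⟩, e⟩
        · change τ x • r ∈ B i
          rwa [e]
        · change τ (τ x • r) = τ x
          rw [e]
      · rintro ⟨t, ⟨-, ht⟩, rfl⟩
        refine ⟨ht.1, ?_⟩
        have := hrep (t • r)
        rwa [hrepD _ _ ht] at this
    rw [himg, Set.ncard_coe_finset, Finset.card_image_of_injOn]
    · rw [Finset.card_filter, Nat.cast_sum]
      refine Finset.sum_congr rfl fun t _ => ?_
      by_cases ht : r ∈ D (i, t) <;> simp [ht]
    · intro t ht t' ht' heq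
      have h1 := (Finset.mem_filter.1 ht).2.2
      have h2 := (Finset.mem_filter.1 ht').2.2
      dsimp only at h1 h2 heq
      rw [← h1, ← h2, heq]
  · refine le_of_eq (Finset.sum_eq_zero fun i _ => Finset.sum_eq_zero fun t _ => ?_).symm
    rw [Set.indicator_of_notMem, mul_zero]
    intro hrD
    have h1 := hrepD _ _ hrD
    refine hr ⟨h1 ▸ hrepA _ (hB i hrD.1), ?_⟩
    have h2 := hrep_eq _ _ (hrep (t • r))
    rw [h1] at h2
    exact h2.symm

/-- Until they exhaust the cluster, the balls in it grow by at least one point at each step. -/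
theorem exists_exhaustedBy_or_card_le {W : Set X} (a : X) (n : ℕ) :
    (∃ m < n, ExhaustedBy S m W a) ∨
      ((n + 1 : ℕ) : ℕ∞) ≤
        {b | ∃ l : List S, l.length ≤ n ∧ PathIn W l a ∧ wordEval l • a = b}.encard := by
  induction n with
  | zero =>
    right
    rw [zero_add, Nat.cast_one, Set.one_le_encard_iff_nonempty]
    exact ⟨a, [], le_rfl, trivial, one_smul _ _⟩
  | succ n ih =>
    rcases ih with ⟨m, hm, h⟩ | ih
    · exact Or.inl ⟨m, hm.trans n.lt_succ_self, h⟩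
    · by_cases hex : ExhaustedBy S n W a
      · exact Or.inl ⟨n, n.lt_succ_self, hex⟩
      · right
        simp only [ExhaustedBy, not_forall] at hex
        obtain ⟨l, hl, hp, hnot⟩ := hex
        have hnotmem : wordEval l • a ∉
            {b | ∃ l : List S, l.length ≤ n ∧ PathIn W l a ∧ wordEval l • a = b} := by
          rintro ⟨l', h1, h2, h3⟩
          exact hnot ⟨l', h1, h2, h3.symm⟩
        have hins := Set.encard_insert_of_notMem hnotmem
        rw [Nat.cast_succ]
        refine (add_le_add_left ih 1).trans (hins.symm.le.trans (Set.encard_le_encard ?_))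
        rintro b (rfl | ⟨l', h1, h2, h3⟩)
        · exact ⟨l, hl, hp, rfl⟩
        · exact ⟨l', h1.trans n.le_succ, h2, h3⟩

/-- Clusters with at most `K` points are spanned by words of length at most `K`, so the connecting
group elements lie in one finite set for all of them. -/
theorem exists_smul_eq_of_encard_cluster_le {W : Set X} {a : X} {K : ℕ}
    (h : (cluster S W a).encard ≤ K) {b : X} (hb : b ∈ cluster S W a) :
    ∃ t ∈ (wordBall_finite S K).toFinset, t • a = b := by
  rcases exists_exhaustedBy_or_card_le (S := S) (W := W) a K with ⟨m, hm, hex⟩ | hle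
  · obtain ⟨l, hl, -, rfl⟩ := hex.word hb
    exact ⟨_, (Set.Finite.mem_toFinset _).2 ⟨l, hl.trans hm.le, rfl⟩, rfl⟩
  · have hsub : {b | ∃ l : List S, l.length ≤ K ∧ PathIn W l a ∧ wordEval l • a = b} ⊆
        cluster S W a := fun b ⟨l, _, hp, he⟩ => mem_cluster_iff_word.2 ⟨l, hp, he⟩
    have := hle.trans ((Set.encard_le_encard hsub).trans h)
    exact absurd this (by exact_mod_cast (Nat.lt_succ_self K).not_ge)

/-- If the sets `B j` are small in the mean, some cluster of `A` meets each of them in a small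
proportion of its points. -/
theorem IsInvariantMean.exists_cluster_inter_le (hS : ∀ s ∈ S, s⁻¹ ∈ S)
    (hμ : IsInvariantMean Γ μ) {A : Set X} {K : ℕ} (hK : ∀ x ∈ A, (cluster S A x).encard ≤ K)
    {J : Type*} (s : Finset J) (B : J → Set X) (η : J → ℝ) (hη : ∀ j, 0 < η j)
    (hlt : ∑ j ∈ s, (η j)⁻¹ * μ (B j) < μ A) :
    ∃ x ∈ A, ∀ j ∈ s,
      ((B j ∩ cluster S A x).ncard : ℝ) ≤ η j * (cluster S A x).ncard := by
  classical
  by_contra! hcon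
  have key := hμ.sum_nonneg_of_clusters hS
    (fun x hx y hy => exists_smul_eq_of_encard_cluster_le (hK x hx) hy) (Finset.insertNone s)
    (fun o => o.elim (-1) fun j => (η j)⁻¹) (fun o => o.elim A fun j => B j ∩ A) (by
      rintro (_ | j)
      · exact le_refl A
      · exact Set.inter_subset_right) (by
      intro x hx
      obtain ⟨j, hj, hjx⟩ := hcon x hx
      have hC : cluster S A x ⊆ A := cluster_subset hx
      rw [Finset.sum_insertNone]
      simp only [Option.elim, Set.inter_eq_right.2 hC, Set.inter_assoc]
      have h1 : ((cluster S A x).ncard : ℝ) ≤ (η j)⁻¹ * (B j ∩ cluster S A x).ncard := by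
        rw [le_inv_mul_iff₀ (hη j)]
        exact hjx.le
      have h2 := Finset.single_le_sum
        (f := fun j => (η j)⁻¹ * ((B j ∩ cluster S A x).ncard : ℝ))
        (fun i _ => mul_nonneg (inv_pos.2 (hη i)).le (Nat.cast_nonneg _)) hj
      linarith)
  rw [Finset.sum_insertNone] at key
  simp only [Option.elim] at key
  have : ∑ j ∈ s, (η j)⁻¹ * μ (B j ∩ A) ≤ ∑ j ∈ s, (η j)⁻¹ * μ (B j) :=
    Finset.sum_le_sum fun j _ =>
      mul_le_mul_of_nonneg_left (hμ.mono Set.inter_subset_left) (inv_pos.2 (hη j)).le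
  linarith

end MassTransport

/-! ### From an invariant mean to a hyperfinite Følner sequence -/

section FolnerOfMean

variable {Γ X : Type*} [Group Γ] [MulAction Γ X] {S : Finset Γ} {μ : Set X → ℝ}

theorem isoConst_le {F : Finset X} (hF : F.Nonempty) (hS : ∀ s ∈ S, s⁻¹ ∈ S) {η : ℝ}
    (h : ∀ s ∈ S, ({x | x ∈ F ∧ s • x ∉ F}.ncard : ℝ) ≤ η * F.card) :
    (schreierGraph X S).isoConst F ≤ S.card * η := by
  have hpos : (0 : ℝ) < F.card := by exact_mod_cast hF.card_pos
  rw [SimpleGraph.isoConst, div_le_iff₀ hpos]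
  have hfin : ∀ s : Γ, {x | x ∈ F ∧ s • x ∉ F}.Finite := fun s =>
    F.finite_toSet.subset fun x hx => hx.1
  have h1 := Set.ncard_le_ncard (edgeBoundary_subset hS F)
    (Set.Finite.biUnion S.finite_toSet fun s _ => (hfin s).image _)
  have h2 := h1.trans (Finset.set_ncard_biUnion_le S _)
  calc _ ≤ ((∑ s ∈ S, ((fun x => (x, s • x)) '' {x | x ∈ F ∧ s • x ∉ F}).ncard : ℕ) : ℝ) := by
        exact_mod_cast h2
    _ = ∑ s ∈ S, (((fun x => (x, s • x)) '' {x | x ∈ F ∧ s • x ∉ F}).ncard : ℝ) := by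
        rw [Nat.cast_sum]
    _ ≤ ∑ s ∈ S, η * F.card := Finset.sum_le_sum fun s hs =>
        le_trans (Nat.cast_le.2 (Set.ncard_image_le (hfin s))) (h s hs)
    _ = S.card * η * F.card := by rw [Finset.sum_const, nsmul_eq_mul, mul_assoc]

/-- The members of the sequence are clusters off the small sets `Y n`: edges leave such a cluster
into `Y n` only, so a cluster that meets the few translates of `Y n` and the earlier `Y j` in small
proportions has small boundary and is well cut by every `Y j`. -/
theorem exists_hyperfinite_folner_of_mean (hS : ∀ s ∈ S, s⁻¹ ∈ S) (hμ : IsInvariantMean Γ μ)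
    (hhyp : ∀ ε : ℝ, 0 < ε → ∃ Y : Set X, μ Y < ε ∧ ∃ K : ℕ, 0 < K ∧
      ∀ x ∈ Yᶜ, (cluster S Yᶜ x).encard ≤ K) :
    ∃ F : ℕ → Finset X, (schreierGraph X S).IsFolnerSeq F ∧
      ∀ ε : ℝ, 0 < ε → ∃ K : ℕ, 0 < K ∧ ∀ n, ∃ Y : Finset X, Y ⊆ F n ∧
        (Y.card : ℝ) < ε * (F n).card ∧
          ∀ x ∈ {x | x ∈ F n ∧ x ∉ Y}, (cluster S {x | x ∈ F n ∧ x ∉ Y} x).encard ≤ K := by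
  classical
  -- The mean of `Y n` has to beat the number of generators times the factor `2 ^ n` with which the
  -- sets are weighted below.
  choose Y hY K hK0 hK using fun n : ℕ =>
    hhyp ((1 / 4 : ℝ) ^ (n + 2) / (S.card + 1)) (by positivity)
  have hS1 : (0 : ℝ) < S.card + 1 := by positivity
  have hY' : ∀ n, (S.card + 1) * μ (Y n) ≤ (1 / 4 : ℝ) ^ (n + 2) := fun n => by
    have := (lt_div_iff₀ hS1).1 (hY n)
    linarith
  have hY1 : ∀ n, μ (Y n) ≤ (1 / 4 : ℝ) ^ (n + 2) := fun n => by
    have h1 := hμ.nonneg (Y n)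
    have h2 : 0 ≤ (S.card : ℝ) * μ (Y n) := by positivity
    linarith [hY' n]
  have h24 : ∀ n : ℕ, ((1 / 2 : ℝ) ^ n)⁻¹ * (1 / 4 : ℝ) ^ (n + 2) = 1 / 16 * (1 / 2) ^ n := by
    intro n
    have : (1 / 4 : ℝ) ^ n = (1 / 2) ^ n * (1 / 2) ^ n := by rw [← mul_pow]; norm_num
    rw [pow_add, this]
    field_simp
    norm_num
  have hgood : ∀ n : ℕ, ∃ x ∈ (Y n)ᶜ,
      (∀ s ∈ S, (({x | s • x ∈ Y n} ∩ cluster S (Y n)ᶜ x).ncard : ℝ) ≤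
        (1 / 2 : ℝ) ^ n * (cluster S (Y n)ᶜ x).ncard) ∧
      ∀ j < n, ((Y j ∩ cluster S (Y n)ᶜ x).ncard : ℝ) ≤
        (1 / 2 : ℝ) ^ j * (cluster S (Y n)ᶜ x).ncard := by
    intro n
    obtain ⟨x, hx, h⟩ := hμ.exists_cluster_inter_le hS (hK n) (S.disjSum (Finset.range n))
      (Sum.elim (fun s => {x | s • x ∈ Y n}) Y)
      (Sum.elim (fun _ => (1 / 2 : ℝ) ^ n) fun j => (1 / 2 : ℝ) ^ j)
      (by rintro (s | j) <;> simp) (by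
        rw [Finset.sum_disjSum]
        simp only [Sum.elim_inl, Sum.elim_inr, hμ.preimage, hμ.compl, Finset.sum_const,
          nsmul_eq_mul]
        have e1 : (S.card : ℝ) * (((1 / 2 : ℝ) ^ n)⁻¹ * μ (Y n)) ≤ 1 / 16 := by
          have h1 : (S.card : ℝ) * μ (Y n) ≤ (1 / 4 : ℝ) ^ (n + 2) := by
            linarith [hY' n, hμ.nonneg (Y n)]
          have h2 := mul_le_mul_of_nonneg_left h1 (show 0 ≤ ((1 / 2 : ℝ) ^ n)⁻¹ by positivity)
          rw [h24] at h2
          have h3 : (1 / 2 : ℝ) ^ n ≤ 1 := pow_le_one₀ (by norm_num) (by norm_num)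
          linarith
        have e2 : ∑ j ∈ Finset.range n, ((1 / 2 : ℝ) ^ j)⁻¹ * μ (Y j) ≤ 1 / 8 := by
          calc _ ≤ ∑ j ∈ Finset.range n, 1 / 16 * (1 / 2 : ℝ) ^ j :=
                Finset.sum_le_sum fun j _ => (h24 j) ▸
                  mul_le_mul_of_nonneg_left (hY1 j) (by positivity)
            _ = 1 / 16 * ∑ j ∈ Finset.range n, (1 / 2 : ℝ) ^ j := by rw [Finset.mul_sum]
            _ ≤ 1 / 16 * 2 := by
                gcongr
                exact sum_geometric_two_le n
            _ = 1 / 8 := by norm_num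
        have e3 : μ (Y n) ≤ 1 / 16 := (hY1 n).trans <| by
          have h3 : (1 / 4 : ℝ) ^ n ≤ 1 := pow_le_one₀ (by norm_num) (by norm_num)
          rw [pow_add]
          linarith
        linarith)
    refine ⟨x, hx, fun s hs => h (Sum.inl s) (by simpa using hs), fun j hj => ?_⟩
    exact h (Sum.inr j) (by simpa using hj)
  choose x hx hxS hxY using hgood
  have hfin : ∀ n, (cluster S (Y n)ᶜ (x n)).Finite := fun n =>
    Set.finite_of_encard_le_coe (hK n _ (hx n))
  let F : ℕ → Finset X := fun n => (hfin n).toFinset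
  have hFcoe : ∀ n, (F n : Set X) = cluster S (Y n)ᶜ (x n) := fun n => (hfin n).coe_toFinset
  have hFmem : ∀ n y, y ∈ F n ↔ y ∈ cluster S (Y n)ᶜ (x n) := fun n y => (hfin n).mem_toFinset
  have hFcard : ∀ n, (cluster S (Y n)ᶜ (x n)).ncard = (F n).card := fun n =>
    Set.ncard_eq_toFinset_card _ (hfin n)
  have hne : ∀ n, (F n).Nonempty := fun n => ⟨x n, (hFmem n _).2 (mem_cluster_self _)⟩
  refine ⟨F, ⟨hne, ?_⟩, fun ε hε => ?_⟩
  · have hle : ∀ n, (schreierGraph X S).isoConst (F n) ≤ S.card * (1 / 2 : ℝ) ^ n := by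
      refine fun n => isoConst_le (hne n) hS fun s hs => ?_
      rw [← hFcard]
      refine le_trans (Nat.cast_le.2 (Set.ncard_le_ncard ?_ ((hfin n).inter_of_right _)))
        (hxS n s hs)
      rintro y ⟨hy, hsy⟩
      rw [hFmem] at hy hsy
      refine ⟨?_, hy⟩
      by_contra hnot
      exact hsy (mem_cluster_of_smul_mem hs (hx n) hy hnot)
    refine squeeze_zero (fun n => by unfold SimpleGraph.isoConst; positivity) hle ?_
    have := (tendsto_pow_atTop_nhds_zero_of_lt_one (r := (1 / 2 : ℝ)) (by norm_num)
      (by norm_num)).const_mul (S.card : ℝ)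
    rwa [mul_zero] at this
  · obtain ⟨j, hj⟩ := exists_pow_lt_of_lt_one hε (show (1 / 2 : ℝ) < 1 by norm_num)
    have hle : ∀ i ≤ j, K i ≤ ∑ i ∈ Finset.range (j + 1), K i := fun i hi =>
      Finset.single_le_sum (fun _ _ => Nat.zero_le _) (Finset.mem_range.2 (Nat.lt_succ_of_le hi))
    refine ⟨∑ i ∈ Finset.range (j + 1), K i, (hK0 j).trans_le (hle j le_rfl), fun n => ?_⟩
    have hpos : (0 : ℝ) < (F n).card := by exact_mod_cast (hne n).card_pos
    rcases le_or_gt n j with hnj | hjn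
    · refine ⟨∅, Finset.empty_subset _, by simpa using mul_pos hε hpos, fun y hy => ?_⟩
      calc _ ≤ (F n : Set X).encard := Set.encard_le_encard fun z hz => (cluster_subset hy hz).1
        _ ≤ K n := by rw [hFcoe]; exact hK n _ (hx n)
        _ ≤ _ := by exact_mod_cast hle n hnj
    · refine ⟨(F n).filter fun y => y ∈ Y j, Finset.filter_subset _ _, ?_, fun y hy => ?_⟩
      · have h1 : (((F n).filter fun y => y ∈ Y j).card : ℝ) ≤ (1 / 2 : ℝ) ^ j * (F n).card := by
          rw [← hFcard]
          refine le_trans (Nat.cast_le.2 ?_) (hxY n j hjn)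
          rw [← Set.ncard_coe_finset]
          refine Set.ncard_le_ncard ?_ ((hfin n).inter_of_right _)
          intro z hz
          obtain ⟨hz1, hz2⟩ := Finset.mem_filter.1 hz
          exact ⟨hz2, (hFmem n z).1 hz1⟩
        exact h1.trans_lt (mul_lt_mul_of_pos_right hj hpos)
      · have hsub : {y | y ∈ F n ∧ y ∉ (F n).filter fun y => y ∈ Y j} ⊆ (Y j)ᶜ :=
          fun z hz hzY => hz.2 (Finset.mem_filter.2 ⟨hz.1, hzY⟩)
        refine (Set.encard_le_encard (cluster_mono hsub y)).trans ((hK j y (hsub hy)).trans ?_)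
        exact_mod_cast hle j le_rfl

end FolnerOfMean

theorem theoremA {Γ X : Type*} [Group Γ] [MulAction Γ X] [Countable X] [Infinite X]
    (S : Finset Γ) (hsymm : ∀ s ∈ S, s⁻¹ ∈ S) (hgen : Subgroup.closure (S : Set Γ) = ⊤) :
    List.TFAE [
      IsHyperfiniteSetAction Γ X,
      ∃ F : ℕ → Finset X, (schreierGraph X S).IsFolnerSeq F ∧
        IsHyperfiniteSeq (fun n => (schreierGraph X S).induce {x | x ∈ F n}),
      ∃ μ : Set X → ℝ, IsInvariantMean Γ μ ∧
        ∀ ε : ℝ, 0 < ε → ∃ Y : Set X, μ Y < ε ∧ ∃ K : ℕ, 0 < K ∧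
          ((schreierGraph X S).induce Yᶜ).ComponentsBoundedBy K] := by
  simp only [isHyperfiniteSeq_induce_iff hsymm, induce_componentsBoundedBy_iff hsymm]
  tfae_have 1 → 3 := by
    rintro ⟨ν, hprob, hreg, hinv, hν⟩
    exact ⟨_, isInvariantMean_of_measure hinv,
      fun ε hε => exists_bounded_clusters_of_measure hinv hν hε⟩
  tfae_have 3 → 1 := fun ⟨μ, hμ, h⟩ => isHyperfiniteSetAction_of_mean hsymm hgen hμ h
  tfae_have 2 → 3 := fun ⟨F, hF, h⟩ => exists_mean_of_hyperfinite_folner hsymm hgen hF h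
  tfae_have 3 → 2 := fun ⟨μ, hμ, h⟩ => exists_hyperfinite_folner_of_mean hsymm hμ h
  tfae_finish
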